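/- Let $\mu=\mathcal N(0,I_d)$ be the standard Gaussian measure on $\mathbb R^d$, and let $\pi$ be a probability measure on $\mathbb R^d$ with a $C^\infty$ density $p\ge 0$ with respect to Lebesgue measure (equivalently, $d\pi\propto \ell\,d\mu$ with $\ell\ge 0$ of class $C^\infty$) and with $\int\|x\|_2^2\,d\pi<\infty$. Let $U_r\in\mathbb R^{d\times r}$ have orthonormal columns, $U_r^\top U_r=I_r$, and let $\widetilde\pi^{\mathrm{KL}}(U_r)$ be the probability measure $$d\widetilde\pi^{\mathrm{KL}}(x\mid U_r)\propto \ell_r^{\mathrm{KL}}(U_r^\top x)\,d\mu(x),\qquad \ell_r^{\mathrm{KL}}(\theta)=\mathbb E_{X\sim\mu}\Big[\tfrac{d\pi}{d\mu}(X)\,\Big|\,U_r^\top X=\theta\Big].$$ Let $M(\pi)=\mathbb E_\pi[XX^\top]$, $C(\pi)=M(\pi)-\mathbb E_\pi[X]\mathbb E_\pi[X]^\top$ and $H(\pi)=\mathbb E_\pi[\nabla\ln p\,(\nabla\ln p)^\top]$. Then $C(\pi)$ is positive definite and $$\mathcal J^\uparrow_{\mathrm{KL}}(U_r)\le D_{\mathrm{KL}}(\pi\,\|\,\widetilde\pi^{\mathrm{KL}}(U_r)),$$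 where $$\mathcal J^\uparrow_{\mathrm{KL}}(U_r)=\frac{\operatorname{tr}M(\pi)-d-\ln\det C(\pi)}2-\frac{\operatorname{tr}(U_r^\top M(\pi)U_r)-r+\ln\det(U_r^\top C(\pi)^{-1}U_r)}2 .$$ If moreover $\mathbb E_\pi\|\nabla\ln p\|_2^2<\infty$, then $H(\pi)$ is positive definite and $$D_{\mathrm{KL}}(\pi\,\|\,\widetilde\pi^{\mathrm{KL}}(U_r))\le\mathcal J^\downarrow_{\mathrm{KL}}(U_r),$$ where $$\mathcal J^\downarrow_{\mathrm{KL}}(U_r)=\frac{\operatorname{tr}M(\pi)-d+\ln\det H(\pi)}2-\frac{\operatorname{tr}(U_r^\top M(\pi)U_r)-r-\ln\det(U_r^\top H(\pi)^{-1}U_r)}2 .$$ (The divergence takes values in $[0,\infty]$; in the second case it is in particular finite.) -/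

import Mathlib

open MeasureTheory ProbabilityTheory InformationTheory

open scoped ENNReal Matrix ContDiff

namespace RidgeKL

noncomputable section

/-- The linear feature map `x ↦ Uᵀ x` from `ℝᵈ` to `ℝʳ`. -/
def feature {d r : ℕ} (U : Matrix (Fin d) (Fin r) ℝ) (x : EuclideanSpace ℝ (Fin d)) :
    EuclideanSpace ℝ (Fin r) :=
  WithLp.toLp 2 (Uᵀ *ᵥ x.ofLp)

/-- The probability measure proportional to `f dμ` (for `0 < ∫ f dμ < ∞`). -/
def normalized {E : Type*} [MeasurableSpace E] (μ : Measure E) (f : E → ℝ≥0∞) : Measure E :=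
  (∫⁻ x, f x ∂μ)⁻¹ • μ.withDensity f

/-- The profile `θ ↦ 𝔼_{X ∼ μ}[ (dπ/dμ)(X) | Uᵀ X = θ ]`, the conditional expectation being taken
with respect to the regular conditional distribution of `X` given `Uᵀ X`. -/
def klProfile {d r : ℕ} (π μ : Measure (EuclideanSpace ℝ (Fin d))) [IsFiniteMeasure μ]
    (U : Matrix (Fin d) (Fin r) ℝ) (θ : EuclideanSpace ℝ (Fin r)) : ℝ≥0∞ :=
  ∫⁻ x, π.rnDeriv μ x ∂(condDistrib id (feature U) μ θ)

/-- The KL-optimal ridge approximation of `π`: the probability measure proportional to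
`klProfile π μ U (Uᵀ x) dμ(x)`. -/
def ridgeApprox {d r : ℕ} (π μ : Measure (EuclideanSpace ℝ (Fin d))) [IsFiniteMeasure μ]
    (U : Matrix (Fin d) (Fin r) ℝ) : Measure (EuclideanSpace ℝ (Fin d)) :=
  normalized μ (fun x => klProfile π μ U (feature U x))

/-- The score `∇ ln p` of a density `p` (only meaningful where `p > 0`). -/
def score {d : ℕ} (p : EuclideanSpace ℝ (Fin d) → ℝ) (x : EuclideanSpace ℝ (Fin d)) :
    EuclideanSpace ℝ (Fin d) :=
  gradient (fun y => Real.log (p y)) x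

/-- Fisher information matrix `𝔼_π[∇ ln p (∇ ln p)ᵀ]` of a measure `π` with Lebesgue density `p`. -/
def fisherMatrix {d : ℕ} (π : Measure (EuclideanSpace ℝ (Fin d)))
    (p : EuclideanSpace ℝ (Fin d) → ℝ) : Matrix (Fin d) (Fin d) ℝ :=
  Matrix.of fun i j => ∫ x, score p x i * score p x j ∂π

/-- Second moment matrix `𝔼_π[X Xᵀ]`. -/
def secondMoment {d : ℕ} (π : Measure (EuclideanSpace ℝ (Fin d))) : Matrix (Fin d) (Fin d) ℝ :=
  Matrix.of fun i j => ∫ x, x i * x j ∂π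

/-- Covariance matrix `𝔼_π[X Xᵀ] - 𝔼_π[X] 𝔼_π[X]ᵀ`. -/
def covMatrix {d : ℕ} (π : Measure (EuclideanSpace ℝ (Fin d))) : Matrix (Fin d) (Fin d) ℝ :=
  secondMoment π - Matrix.vecMulVec (fun i => ∫ x, x i ∂π) (fun i => ∫ x, x i ∂π)

/-- The majorant, as a function of the Fisher matrix `H`, the second moment matrix `M`
and the features `U`. -/
def majorant {d r : ℕ} (H M : Matrix (Fin d) (Fin d) ℝ) (U : Matrix (Fin d) (Fin r) ℝ) : ℝ :=
  (M.trace - d + Real.log H.det) / 2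
    - ((Uᵀ * M * U).trace - r - Real.log (Uᵀ * H⁻¹ * U).det) / 2

/-- The minorant, as a function of the covariance matrix `C`, the second moment matrix `M`
and the features `U`. -/
def minorant {d r : ℕ} (C M : Matrix (Fin d) (Fin d) ℝ) (U : Matrix (Fin d) (Fin r) ℝ) : ℝ :=
  (M.trace - d - Real.log C.det) / 2
    - ((Uᵀ * M * U).trace - r + Real.log (Uᵀ * C⁻¹ * U).det) / 2

end

end RidgeKL

/-! Complete the columns of U to an orthonormal basis of the space. In the coordinates y of this
basis μ is a product of standard normal laws. Let f = dπ/dμ, let s be the set of coordinates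
orthogonal to the features, and let f_s be f integrated over the coordinates in s. The ridge
approximation has density f_s with respect to μ, so the divergence is the relative entropy of f with
respect to f_s (`klDiv_ridgeApprox`). Both bounds are then found one coordinate of s at a time.

Upper bound. Relative entropy is subadditive under resampling of coordinates
(`lintegral_klDensity_lmarginal_le_sum`), so it is enough to treat a single coordinate, that is,
densities on a line. There, for second moment m, Fisher information I and every a > 0, the
divergence from the normal law is at most (m + a² I)/2 - 1 - log a (`lintegral_klFun_le`). The proof
uses the monotone transport T to the normal law with density φ: the bound log(aρ/φ(T)) ≤ aρ/φ(T) -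
1, the square (aρ'/ρ + T)² ≥ 0, and the fact that (ρT)' integrates to zero. The bound is linear in m
and I, so it can be averaged over all lines parallel to the j-th axis with the same a. Choosing a =
h_j^(-1/2) only afterwards, with h_j the Fisher information in direction j, gives (m_j - 1 + log
h_j)/2.

Lower bound. In the Donsker-Varadhan inequality take as test function the sum over s of the
log-densities, relative to the standard normal, of the normal laws with the mean and variance of the
coordinates of π. Its exponential integrates to one against f_s μ because f_s ignores the
coordinates in s. This gives (v_j - 1 - log c_j)/2 per coordinate (`ofReal_le_lintegral_klDensity`).

Determinants. The basis V of the orthogonal complement is free. It is chosen to diagonalise VᵀAV,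
with A the Fisher matrix for the upper bound and the covariance for the lower one. The sum of the
logarithms of the diagonal entries is then log det VᵀAV, which Jacobi's complementary minor identity
turns into log det A + log det UᵀA⁻¹U (`exists_adapted_orthonormalBasis`). -/

namespace RidgeKL

/-! ### Entropy, second moment and Fisher information on the line -/

section LineInequality

open Set Filter Topology

lemma hasDerivAt_setIntegral_Iic {ρ : ℝ → ℝ} (hc : Continuous ρ) (hi : Integrable ρ) (x : ℝ) :
    HasDerivAt (fun x => ∫ t in Iic x, ρ t) (ρ x) x := by
  have h : (fun x => ∫ t in Iic x, ρ t) =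
      fun x => (∫ t in Iic (0 : ℝ), ρ t) + ∫ t in (0 : ℝ)..x, ρ t := by
    ext y
    rw [← intervalIntegral.integral_Iic_sub_Iic hi.integrableOn hi.integrableOn]
    ring
  rw [h]
  exact (intervalIntegral.integral_hasDerivAt_right (hc.intervalIntegrable _ _)
    (hc.stronglyMeasurableAtFilter _ _) hc.continuousAt).const_add _

lemma continuous_setIntegral_Iic {ρ : ℝ → ℝ} (hc : Continuous ρ) (hi : Integrable ρ) :
    Continuous (fun x => ∫ t in Iic x, ρ t) :=
  continuous_iff_continuousAt.2 fun x => (hasDerivAt_setIntegral_Iic hc hi x).continuousAt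

lemma tendsto_setIntegral_Iic_atTop {ρ : ℝ → ℝ} (hi : Integrable ρ) :
    Tendsto (fun x => ∫ t in Iic x, ρ t) atTop (𝓝 (∫ t, ρ t)) :=
  (aecover_Iic tendsto_id).integral_tendsto_of_countably_generated hi

lemma tendsto_setIntegral_Ioi_atBot {ρ : ℝ → ℝ} (hi : Integrable ρ) :
    Tendsto (fun x => ∫ t in Ioi x, ρ t) atBot (𝓝 (∫ t, ρ t)) :=
  (aecover_Ioi tendsto_id).integral_tendsto_of_countably_generated hi

lemma setIntegral_Iic_eq_sub {ρ : ℝ → ℝ} (hi : Integrable ρ) (x : ℝ) :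
    ∫ t in Iic x, ρ t = (∫ t, ρ t) - ∫ t in Ioi x, ρ t := by
  rw [← integral_add_compl (measurableSet_Iic (a := x)) hi, compl_Iic]
  ring

lemma tendsto_setIntegral_Iic_atBot {ρ : ℝ → ℝ} (hi : Integrable ρ) :
    Tendsto (fun x => ∫ t in Iic x, ρ t) atBot (𝓝 0) := by
  simp_rw [setIntegral_Iic_eq_sub hi]
  simpa using (tendsto_setIntegral_Ioi_atBot hi).const_sub (∫ t, ρ t)

lemma tendsto_setIntegral_Ioi_atTop {ρ : ℝ → ℝ} (hi : Integrable ρ) :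
    Tendsto (fun x => ∫ t in Ioi x, ρ t) atTop (𝓝 0) := by
  have h : ∀ x, ∫ t in Ioi x, ρ t = (∫ t, ρ t) - ∫ t in Iic x, ρ t := fun x => by
    rw [setIntegral_Iic_eq_sub hi]; ring
  simp_rw [h]
  simpa using (tendsto_setIntegral_Iic_atTop hi).const_sub (∫ t, ρ t)

/-- The density of the standard normal law. -/
noncomputable def normalPDF (x : ℝ) : ℝ := gaussianPDFReal 0 1 x

/-- The cumulative distribution function of the standard normal law. -/
noncomputable def normalCDF (x : ℝ) : ℝ := ∫ t in Iic x, normalPDF t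

lemma normalPDF_eq (x : ℝ) :
    normalPDF x = Real.exp (-(x ^ 2 / 2) - Real.log (2 * Real.pi) / 2) := by
  have h : 0 < 2 * Real.pi := by positivity
  rw [normalPDF, gaussianPDFReal, sub_eq_add_neg (-(x ^ 2 / 2)), Real.exp_add, mul_comm]
  congr 1
  · congr 1; simp; ring
  · rw [Real.exp_neg, ← Real.log_sqrt h.le, Real.exp_log (Real.sqrt_pos.2 h)]
    simp

lemma normalPDF_pos (x : ℝ) : 0 < normalPDF x := gaussianPDFReal_pos _ _ _ one_ne_zero

lemma log_normalPDF (x : ℝ) :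
    Real.log (normalPDF x) = -(x ^ 2 / 2) - Real.log (2 * Real.pi) / 2 := by
  rw [normalPDF_eq, Real.log_exp]

lemma contDiff_normalPDF {n : WithTop ℕ∞} : ContDiff ℝ n normalPDF := by
  rw [show normalPDF = _ from funext normalPDF_eq]
  fun_prop

lemma continuous_normalPDF : Continuous normalPDF := contDiff_normalPDF (n := 0).continuous

lemma integrable_normalPDF : Integrable normalPDF := integrable_gaussianPDFReal 0 1

lemma integral_normalPDF : ∫ x, normalPDF x = 1 := integral_gaussianPDFReal_eq_one 0 one_ne_zero

lemma integrable_sq_mul_normalPDF : Integrable (fun x => x ^ 2 * normalPDF x) := by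
  have h : Integrable (fun x : ℝ => x ^ 2) (gaussianReal 0 1) := by
    exact (memLp_id_gaussianReal (μ := 0) (v := 1) 2).integrable_sq
  rw [gaussianReal_of_var_ne_zero _ one_ne_zero, integrable_withDensity_iff_integrable_smul'
    (measurable_gaussianPDF 0 1) (ae_of_all _ fun _ => gaussianPDF_lt_top)] at h
  simpa [toReal_gaussianPDF, mul_comm, normalPDF] using h

lemma hasDerivAt_normalCDF (x : ℝ) : HasDerivAt normalCDF (normalPDF x) x :=
  hasDerivAt_setIntegral_Iic continuous_normalPDF integrable_normalPDF x

lemma strictMono_normalCDF : StrictMono normalCDF :=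
  strictMono_of_hasDerivAt_pos hasDerivAt_normalCDF normalPDF_pos

lemma continuous_normalCDF : Continuous normalCDF :=
  continuous_setIntegral_Iic continuous_normalPDF integrable_normalPDF

lemma tendsto_normalCDF_atTop : Tendsto normalCDF atTop (𝓝 1) :=
  integral_normalPDF ▸ tendsto_setIntegral_Iic_atTop integrable_normalPDF

lemma tendsto_normalCDF_atBot : Tendsto normalCDF atBot (𝓝 0) :=
  tendsto_setIntegral_Iic_atBot integrable_normalPDF

lemma normalCDF_mem_Ioo (x : ℝ) : normalCDF x ∈ Ioo (0 : ℝ) 1 := by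
  refine ⟨(strictMono_normalCDF (sub_one_lt x)).trans_le' ?_,
    (strictMono_normalCDF (lt_add_one x)).trans_le ?_⟩
  · exact strictMono_normalCDF.monotone.le_of_tendsto tendsto_normalCDF_atBot _
  · exact strictMono_normalCDF.monotone.ge_of_tendsto tendsto_normalCDF_atTop _

lemma exists_eq_of_tendsto {F : ℝ → ℝ} (hF : Continuous F) (h0 : Tendsto F atBot (𝓝 0))
    (h1 : Tendsto F atTop (𝓝 1)) {u : ℝ} (hu : u ∈ Ioo (0 : ℝ) 1) : ∃ x, F x = u := by
  obtain ⟨x, hx⟩ := (h0.eventually (gt_mem_nhds hu.1)).exists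
  obtain ⟨y, hy⟩ := (h1.eventually (lt_mem_nhds hu.2)).exists
  exact mem_range_of_exists_le_of_exists_ge hF ⟨x, hx.le⟩ ⟨y, hy.le⟩

lemma range_normalCDF : range normalCDF = Ioo (0 : ℝ) 1 := by
  ext u
  refine ⟨?_, fun hu => exists_eq_of_tendsto continuous_normalCDF tendsto_normalCDF_atBot
    tendsto_normalCDF_atTop hu⟩
  rintro ⟨x, rfl⟩
  exact normalCDF_mem_Ioo x

/-- The quantile function of the standard normal law. -/
noncomputable def normalQuantile : ℝ → ℝ := Function.invFun normalCDF

lemma normalQuantile_normalCDF (x : ℝ) : normalQuantile (normalCDF x) = x :=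
  Function.leftInverse_invFun strictMono_normalCDF.injective x

lemma normalCDF_normalQuantile {u : ℝ} (hu : u ∈ Ioo (0 : ℝ) 1) :
    normalCDF (normalQuantile u) = u :=
  Function.invFun_eq (range_normalCDF.symm ▸ hu : u ∈ range normalCDF)

lemma hasDerivAt_normalQuantile {u : ℝ} (hu : u ∈ Ioo (0 : ℝ) 1) :
    HasDerivAt normalQuantile (normalPDF (normalQuantile u))⁻¹ u := by
  have hemb : IsOpenEmbedding normalCDF :=
    ⟨strictMono_normalCDF.isEmbedding_of_ordConnected
      (by rw [range_normalCDF]; exact ordConnected_Ioo),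
      by rw [range_normalCDF]; exact isOpen_Ioo⟩
  have hcont : ContinuousAt normalQuantile u := by
    rw [← normalCDF_normalQuantile hu, ← hemb.continuousAt_iff]
    have : normalQuantile ∘ normalCDF = id := funext normalQuantile_normalCDF
    rw [this]
    exact continuousAt_id
  refine HasDerivAt.of_local_left_inverse hcont (hasDerivAt_normalCDF _) (normalPDF_pos _).ne' ?_
  filter_upwards [isOpen_Ioo.mem_nhds hu] with v hv using normalCDF_normalQuantile hv

lemma tendsto_mul_sqrt_zero_of_sq {g : ℕ → ℝ}
    (h : Tendsto (fun k : ℕ => (k : ℝ) ^ 2 * g k) atTop (𝓝 0)) :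
    Tendsto (fun k : ℕ => (k : ℝ) * √(g k)) atTop (𝓝 0) := by
  have h2 := (Real.continuous_sqrt.tendsto 0).comp h
  rw [Real.sqrt_zero] at h2
  refine h2.congr fun k => ?_
  simp [Real.sqrt_mul (sq_nonneg (k : ℝ))]

/-- Chebyshev: k² times the tail beyond k is at most the second moment carried by that tail. This
limit, with its mirror image, kills the boundary terms ρT in the integration by parts. -/
lemma tendsto_mul_sqrt_one_sub_normalCDF :
    Tendsto (fun k : ℕ => (k : ℝ) * √(1 - normalCDF k)) atTop (𝓝 0) := by
  refine tendsto_mul_sqrt_zero_of_sq ?_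
  refine squeeze_zero (fun k => mul_nonneg (sq_nonneg _) (sub_nonneg.2 (normalCDF_mem_Ioo _).2.le))
    (fun k => ?_) ((tendsto_setIntegral_Ioi_atTop integrable_sq_mul_normalPDF).comp
      tendsto_natCast_atTop_atTop)
  have : 1 - normalCDF k = ∫ t in Ioi (k : ℝ), normalPDF t := by
    rw [normalCDF, setIntegral_Iic_eq_sub integrable_normalPDF, integral_normalPDF]; ring
  rw [this, ← integral_const_mul]
  refine setIntegral_mono_on (integrable_normalPDF.const_mul _).integrableOn
    integrable_sq_mul_normalPDF.integrableOn measurableSet_Ioi fun t ht => ?_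
  have : (k : ℝ) < t := ht
  have := normalPDF_pos t
  gcongr

lemma tendsto_mul_sqrt_normalCDF_neg :
    Tendsto (fun k : ℕ => (k : ℝ) * √(normalCDF (-k))) atTop (𝓝 0) := by
  refine tendsto_mul_sqrt_zero_of_sq ?_
  refine squeeze_zero (fun k => mul_nonneg (sq_nonneg _) (normalCDF_mem_Ioo _).1.le)
    (fun k => ?_) ((tendsto_setIntegral_Iic_atBot integrable_sq_mul_normalPDF).comp
      (tendsto_neg_atTop_atBot.comp tendsto_natCast_atTop_atTop))
  rw [normalCDF, ← integral_const_mul]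
  refine setIntegral_mono_on (integrable_normalPDF.const_mul _).integrableOn
    integrable_sq_mul_normalPDF.integrableOn measurableSet_Iic fun t ht => ?_
  have h1 : t ≤ -(k : ℝ) := ht
  have h2 : (k : ℝ) ^ 2 ≤ t ^ 2 := by
    have : (0 : ℝ) ≤ k := k.cast_nonneg
    nlinarith
  have := normalPDF_pos t
  gcongr

/-- A zero of a nonnegative function is a minimum, so the derivative vanishes there as well, and the
value 0 of `logDeriv` at such points does no harm. -/
lemma deriv_eq_logDeriv_mul {ρ : ℝ → ℝ} (h0 : ∀ x, 0 ≤ ρ x) (x : ℝ) :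
    deriv ρ x = logDeriv ρ x * ρ x := by
  by_cases hx : ρ x = 0
  · have : IsLocalMin ρ x := Eventually.of_forall fun y => hx ▸ h0 y
    rw [this.deriv_eq_zero, hx, mul_zero]
  · rw [logDeriv_apply, div_mul_cancel₀ _ hx]

lemma integrable_deriv_of_fisher {ρ : ℝ → ℝ} (hρ : ContDiff ℝ 1 ρ) (h0 : ∀ x, 0 ≤ ρ x)
    (hi : Integrable ρ) (hσ : Integrable (fun x => logDeriv ρ x ^ 2 * ρ x)) :
    Integrable (deriv ρ) := by
  refine ((hσ.add hi).div_const 2).mono' (hρ.continuous_deriv le_rfl).aestronglyMeasurable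
    (ae_of_all _ fun x => ?_)
  rw [deriv_eq_logDeriv_mul h0, Real.norm_eq_abs, abs_mul, abs_of_nonneg (h0 x), Pi.add_apply,
    ← sq_abs]
  nlinarith [mul_nonneg (sq_nonneg (|logDeriv ρ x| - 1)) (h0 x)]

/-- Cauchy-Schwarz in the additive form |S| ≤ l S²/2 + 1/(2l), with l the square root of the mass of
s; hence the constant (I + 1)/2 instead of √I. -/
lemma setIntegral_abs_deriv_le {ρ : ℝ → ℝ} (hρ : ContDiff ℝ 1 ρ) (h0 : ∀ x, 0 ≤ ρ x)
    (hi : Integrable ρ) (hσ : Integrable (fun x => logDeriv ρ x ^ 2 * ρ x)) {s : Set ℝ}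
    (hs : 0 < ∫ x in s, ρ x) :
    ∫ x in s, |deriv ρ x| ≤ ((∫ x, logDeriv ρ x ^ 2 * ρ x) + 1) / 2 * √(∫ x in s, ρ x) := by
  set m := ∫ x in s, ρ x
  set l := √m with hl
  have hl0 : 0 < l := Real.sqrt_pos.2 hs
  have hlm : l⁻¹ * m = l := by
    rw [← Real.mul_self_sqrt hs.le, ← hl]; field_simp
  calc ∫ x in s, |deriv ρ x|
      ≤ ∫ x in s, (l / 2 * (logDeriv ρ x ^ 2 * ρ x) + l⁻¹ / 2 * ρ x) := by
        refine integral_mono (integrable_deriv_of_fisher hρ h0 hi hσ).abs.integrableOn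
          ((hσ.const_mul _).add (hi.const_mul _)).integrableOn fun x => ?_
        simp only
        rw [deriv_eq_logDeriv_mul h0, abs_mul, abs_of_nonneg (h0 x), ← sq_abs (logDeriv ρ x)]
        have h1 := mul_nonneg (mul_nonneg (sq_nonneg (l * |logDeriv ρ x| - 1)) (h0 x))
          (inv_nonneg.2 hl0.le)
        have h2 : (l * |logDeriv ρ x| - 1) ^ 2 * ρ x * l⁻¹ =
          2 * (l / 2 * (|logDeriv ρ x| ^ 2 * ρ x) + l⁻¹ / 2 * ρ x - |logDeriv ρ x| * ρ x) := by
          field_simp; ring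
        linarith
    _ = l / 2 * (∫ x in s, logDeriv ρ x ^ 2 * ρ x) + l⁻¹ / 2 * m := by
        rw [integral_add (hσ.const_mul _).integrableOn (hi.const_mul _).integrableOn,
          integral_const_mul, integral_const_mul]
    _ ≤ l / 2 * (∫ x, logDeriv ρ x ^ 2 * ρ x) + l⁻¹ / 2 * m := by
        have := setIntegral_le_integral (s := s) hσ
          (ae_of_all _ fun x => mul_nonneg (sq_nonneg _) (h0 x))
        gcongr
    _ = _ := by linear_combination hlm / 2

/-- Since ρ and ρ' are integrable, ρ vanishes at infinity, and ρ x is minus the integral of ρ' over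
the tail. -/
lemma le_sqrt_setIntegral_Ioi {ρ : ℝ → ℝ} (hρ : ContDiff ℝ 1 ρ) (h0 : ∀ x, 0 ≤ ρ x)
    (hi : Integrable ρ) (hσ : Integrable (fun x => logDeriv ρ x ^ 2 * ρ x)) {x : ℝ}
    (hs : 0 < ∫ t in Ioi x, ρ t) :
    ρ x ≤ ((∫ x, logDeriv ρ x ^ 2 * ρ x) + 1) / 2 * √(∫ t in Ioi x, ρ t) := by
  have hd : ∀ t, HasDerivAt ρ (deriv ρ t) t :=
    fun t => (hρ.differentiable one_ne_zero t).hasDerivAt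
  have hid := integrable_deriv_of_fisher hρ h0 hi hσ
  refine le_trans ?_ (setIntegral_abs_deriv_le hρ h0 hi hσ hs)
  have h := integral_Ioi_of_hasDerivAt_of_tendsto' (a := x) (fun t _ => hd t) hid.integrableOn
    (tendsto_zero_of_hasDerivAt_of_integrableOn_Ioi (a := x) (fun t _ => hd t)
      hid.integrableOn hi.integrableOn)
  have h2 := norm_integral_le_integral_norm (μ := volume.restrict (Ioi x)) (deriv ρ)
  rw [h, zero_sub, norm_neg, Real.norm_eq_abs, abs_of_nonneg (h0 x)] at h2
  exact h2

lemma le_sqrt_setIntegral_Iic {ρ : ℝ → ℝ} (hρ : ContDiff ℝ 1 ρ) (h0 : ∀ x, 0 ≤ ρ x)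
    (hi : Integrable ρ) (hσ : Integrable (fun x => logDeriv ρ x ^ 2 * ρ x)) {x : ℝ}
    (hs : 0 < ∫ t in Iic x, ρ t) :
    ρ x ≤ ((∫ x, logDeriv ρ x ^ 2 * ρ x) + 1) / 2 * √(∫ t in Iic x, ρ t) := by
  have hd : ∀ t, HasDerivAt ρ (deriv ρ t) t :=
    fun t => (hρ.differentiable one_ne_zero t).hasDerivAt
  have hid := integrable_deriv_of_fisher hρ h0 hi hσ
  refine le_trans ?_ (setIntegral_abs_deriv_le hρ h0 hi hσ hs)
  have h := integral_Iic_of_hasDerivAt_of_tendsto' (a := x) (fun t _ => hd t) hid.integrableOn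
    (tendsto_zero_of_hasDerivAt_of_integrableOn_Iic (a := x) (fun t _ => hd t)
      hid.integrableOn hi.integrableOn)
  have h2 := norm_integral_le_integral_norm (μ := volume.restrict (Iic x)) (deriv ρ)
  rw [h, sub_zero, Real.norm_eq_abs, abs_of_nonneg (h0 x)] at h2
  exact h2

/-- The monotone map transporting the density `ρ` to the standard normal law. -/
noncomputable def normalTransport (ρ : ℝ → ℝ) (x : ℝ) : ℝ :=
  normalQuantile (∫ t in Iic x, ρ t)

lemma hasDerivAt_normalTransport {ρ : ℝ → ℝ} (hc : Continuous ρ) (hi : Integrable ρ) {x : ℝ}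
    (hx : ∫ t in Iic x, ρ t ∈ Ioo (0 : ℝ) 1) :
    HasDerivAt (normalTransport ρ) (ρ x / normalPDF (normalTransport ρ x)) x := by
  have := (hasDerivAt_normalQuantile hx).comp x (hasDerivAt_setIntegral_Iic hc hi x)
  rwa [inv_mul_eq_div] at this

/-- Multiply log(aρ/φ(t)) ≤ aρ/φ(t) - 1 by ρ, and absorb the resulting -t²ρ/2 through (aρ'/ρ + t)²ρ
≥ 0. With t = T(x) the bracket after a becomes the exact derivative (ρT)', because T' = ρ/φ(T). -/
lemma entropy_le_deriv_mul_transport {ρ : ℝ → ℝ} (h0 : ∀ x, 0 ≤ ρ x) {a : ℝ} (ha : 0 < a)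
    (x t : ℝ) :
    ρ x * Real.log (ρ x) + ρ x * (1 + Real.log a + Real.log (2 * Real.pi) / 2) ≤
      a * (deriv ρ x * t + ρ x * (ρ x / normalPDF t)) +
        a ^ 2 / 2 * (logDeriv ρ x ^ 2 * ρ x) := by
  rw [deriv_eq_logDeriv_mul h0]
  rcases (h0 x).eq_or_lt with hx | hx
  · simp [← hx]
  · have hφ := normalPDF_pos t
    have h1 := Real.log_le_sub_one_of_pos (show 0 < a * (ρ x / normalPDF t) by positivity)
    rw [Real.log_mul ha.ne' (by positivity), Real.log_div hx.ne' hφ.ne', log_normalPDF] at h1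
    have h2 := mul_le_mul_of_nonneg_left h1 hx.le
    have h3 := mul_nonneg (sq_nonneg (a * logDeriv ρ x + t)) hx.le
    linarith

lemma normalPDF_mul_klFun {r x : ℝ} (hr : 0 ≤ r) :
    normalPDF x * klFun (r / normalPDF x) =
      r * Real.log r + x ^ 2 / 2 * r + Real.log (2 * Real.pi) / 2 * r + normalPDF x - r := by
  have hφ := normalPDF_pos x
  rcases hr.eq_or_lt with rfl | hr
  · simp [klFun]
  · rw [klFun, Real.log_div hr.ne' hφ.ne', log_normalPDF]
    field_simp
    ring

/-- Where the distribution function is 0 or 1 it is at an extremum, so its derivative ρ is zero. Off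
this set the transport is differentiable. -/
lemma eq_zero_of_setIntegral_Iic_notMem_Ioo {ρ : ℝ → ℝ} (hc : Continuous ρ) (h0 : ∀ x, 0 ≤ ρ x)
    (hi : Integrable ρ) (h1 : ∫ x, ρ x = 1) {x : ℝ} (hx : ∫ t in Iic x, ρ t ∉ Ioo (0 : ℝ) 1) :
    ρ x = 0 := by
  have hge : ∀ y, 0 ≤ ∫ t in Iic y, ρ t := fun y => integral_nonneg h0
  have hle : ∀ y, ∫ t in Iic y, ρ t ≤ 1 := fun y =>
    h1 ▸ setIntegral_le_integral hi (ae_of_all _ h0)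
  have hd := hasDerivAt_setIntegral_Iic hc hi x
  rcases (hge x).eq_or_lt with h | h
  · have : IsLocalMin (fun y => ∫ t in Iic y, ρ t) x := Eventually.of_forall fun y => by
      simpa [← h] using hge y
    exact this.hasDerivAt_eq_zero hd
  · have h' : ∫ t in Iic x, ρ t = 1 := (hle x).antisymm (not_lt.1 fun h' => hx ⟨h, h'⟩)
    have : IsLocalMax (fun y => ∫ t in Iic y, ρ t) x := Eventually.of_forall fun y => by
      simpa [h'] using hle y
    exact this.hasDerivAt_eq_zero hd

/-- The pointwise bound at t = T(x), integrated over an interval on which T is differentiable; only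
the boundary values of ρT remain. W collects every other term. -/
lemma setIntegral_Icc_klFun_le {ρ : ℝ → ℝ} (hρ : ContDiff ℝ 1 ρ) (h0 : ∀ x, 0 ≤ ρ x)
    (hi : Integrable ρ) {a : ℝ} (ha : 0 < a) {W : ℝ → ℝ} (hW : Integrable W)
    (hWeq : ∀ x, W x = a ^ 2 / 2 * (logDeriv ρ x ^ 2 * ρ x) + x ^ 2 / 2 * ρ x
      - (2 + Real.log a) * ρ x + normalPDF x)
    {α β : ℝ} (hαβ : α ≤ β) (hF : ∀ x ∈ Icc α β, ∫ t in Iic x, ρ t ∈ Ioo (0 : ℝ) 1) :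
    ∫ x in Icc α β, normalPDF x * klFun (ρ x / normalPDF x) ≤
      (∫ x in Icc α β, W x) +
        a * (ρ β * normalTransport ρ β - ρ α * normalTransport ρ α) := by
  set T := normalTransport ρ
  have hT : ∀ x ∈ Icc α β, HasDerivAt T (ρ x / normalPDF (T x)) x := fun x hx =>
    hasDerivAt_normalTransport hρ.continuous hi (hF x hx)
  have hTc : ContinuousOn T (Icc α β) := fun x hx => (hT x hx).continuousAt.continuousWithinAt
  set D : ℝ → ℝ := fun x => deriv ρ x * T x + ρ x * (ρ x / normalPDF (T x))
  have hD : ∀ x ∈ Icc α β, HasDerivAt (fun x => ρ x * T x) (D x) x := fun x hx =>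
    ((hρ.differentiable one_ne_zero x).hasDerivAt).mul (hT x hx)
  have hDc : ContinuousOn D (Icc α β) := by
    refine ((hρ.continuous_deriv le_rfl).continuousOn.mul hTc).add
      (hρ.continuous.continuousOn.mul (hρ.continuous.continuousOn.div
        (continuous_normalPDF.comp_continuousOn hTc) fun x _ => (normalPDF_pos _).ne'))
  have hDi : IntegrableOn D (Icc α β) := hDc.integrableOn_compact isCompact_Icc
  have hint : ∫ x in Icc α β, D x = ρ β * T β - ρ α * T α := by
    rw [integral_Icc_eq_integral_Ioc, ← intervalIntegral.integral_of_le hαβ]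
    refine intervalIntegral.integral_eq_sub_of_hasDerivAt (fun x hx => hD x ?_) ?_
    · rwa [uIcc_of_le hαβ] at hx
    · exact (uIcc_of_le hαβ ▸ hDc).intervalIntegrable
  have hκc : Continuous fun x => normalPDF x * klFun (ρ x / normalPDF x) :=
    continuous_normalPDF.mul (continuous_klFun.comp
      (hρ.continuous.div continuous_normalPDF fun x => (normalPDF_pos x).ne'))
  rw [← hint, ← integral_const_mul, ← integral_add hW.integrableOn (hDi.const_mul a)]
  refine setIntegral_mono_on (hκc.continuousOn.integrableOn_compact isCompact_Icc)
    (hW.integrableOn.add (hDi.const_mul a)) measurableSet_Icc fun x hx => ?_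
  rw [normalPDF_mul_klFun (h0 x), hWeq]
  have := entropy_le_deriv_mul_transport h0 ha x (T x)
  simp only [D]
  linarith

theorem lintegral_klFun_le_of_integrable {ρ : ℝ → ℝ} (hρ : ContDiff ℝ 1 ρ) (h0 : ∀ x, 0 ≤ ρ x)
    (hi : Integrable ρ) (h1 : ∫ x, ρ x = 1)
    (hσ : Integrable (fun x => logDeriv ρ x ^ 2 * ρ x))
    (hm : Integrable (fun x => x ^ 2 * ρ x)) {a : ℝ} (ha : 0 < a) :
    0 ≤ a ^ 2 / 2 * (∫ x, logDeriv ρ x ^ 2 * ρ x) + (∫ x, x ^ 2 * ρ x) / 2 - 1 - Real.log a ∧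
    ∫⁻ x, ENNReal.ofReal (normalPDF x * klFun (ρ x / normalPDF x)) ≤
      ENNReal.ofReal (a ^ 2 / 2 * (∫ x, logDeriv ρ x ^ 2 * ρ x) + (∫ x, x ^ 2 * ρ x) / 2
        - 1 - Real.log a) := by
  set F : ℝ → ℝ := fun x => ∫ t in Iic x, ρ t with hFdef
  set κ : ℝ → ℝ := fun x => normalPDF x * klFun (ρ x / normalPDF x) with hκdef
  have hκ0 : ∀ x, 0 ≤ κ x := fun x => mul_nonneg (normalPDF_pos x).le
    (klFun_nonneg (div_nonneg (h0 x) (normalPDF_pos x).le))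
  have hκc : Continuous κ := continuous_normalPDF.mul (continuous_klFun.comp
    (hρ.continuous.div continuous_normalPDF fun x => (normalPDF_pos x).ne'))
  set W : ℝ → ℝ := fun x => a ^ 2 / 2 * (logDeriv ρ x ^ 2 * ρ x) + x ^ 2 / 2 * ρ x
      - (2 + Real.log a) * ρ x + normalPDF x with hWdef
  have hm' : Integrable fun x => x ^ 2 / 2 * ρ x := by
    simpa only [div_mul_eq_mul_div] using hm.div_const 2
  have hW : Integrable W := (((hσ.const_mul _).add hm').sub (hi.const_mul _)).add
    integrable_normalPDF
  have hWint : ∫ x, W x = a ^ 2 / 2 * (∫ x, logDeriv ρ x ^ 2 * ρ x) + (∫ x, x ^ 2 * ρ x) / 2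
        - 1 - Real.log a := by
    have i1 : Integrable fun x => a ^ 2 / 2 * (logDeriv ρ x ^ 2 * ρ x) := hσ.const_mul _
    have i2 : Integrable fun x => a ^ 2 / 2 * (logDeriv ρ x ^ 2 * ρ x) + x ^ 2 / 2 * ρ x := i1.add hm'
    have i3 : Integrable fun x => (2 + Real.log a) * ρ x := hi.const_mul _
    have i4 : Integrable fun x => a ^ 2 / 2 * (logDeriv ρ x ^ 2 * ρ x) + x ^ 2 / 2 * ρ x -
      (2 + Real.log a) * ρ x := i2.sub i3
    simp only [hWdef]
    rw [integral_add i4 integrable_normalPDF, integral_sub i2 i3, integral_add i1 hm',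
      integral_const_mul, integral_const_mul, h1, integral_normalPDF, ← integral_div]
    simp only [div_mul_eq_mul_div]
    ring
  have hFc : Continuous F := continuous_setIntegral_Iic hρ.continuous hi
  have hFm : Monotone F := monotone_of_hasDerivAt_nonneg
    (hasDerivAt_setIntegral_Iic hρ.continuous hi) h0
  have hF0 : Tendsto F atBot (𝓝 0) := tendsto_setIntegral_Iic_atBot hi
  have hF1 : Tendsto F atTop (𝓝 1) := h1 ▸ tendsto_setIntegral_Iic_atTop hi
  -- The endpoints are the points where the transport equals -k and k, so the boundary terms are k
  -- ρ(β k) + k ρ(α k).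
  choose α hα using fun k : ℕ => exists_eq_of_tendsto hFc hF0 hF1 (normalCDF_mem_Ioo (-(k : ℝ)))
  choose β hβ using fun k : ℕ => exists_eq_of_tendsto hFc hF0 hF1 (normalCDF_mem_Ioo (k : ℝ))
  have hsub : ∀ k, ∀ x ∈ Icc (α k) (β k), F x ∈ Ioo (0 : ℝ) 1 := fun k x hx =>
    ⟨((normalCDF_mem_Ioo _).1.trans_eq (hα k).symm).trans_le (hFm hx.1),
      ((hFm hx.2).trans_eq (hβ k)).trans_lt (normalCDF_mem_Ioo _).2⟩
  -- On Z the density is zero and both integrands equal the normal density, so Z is added to the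
  -- intervals to cover the line.
  set Z : Set ℝ := {x | F x ∉ Ioo (0 : ℝ) 1} with hZdef
  have hZm : MeasurableSet Z := (hFc.measurable measurableSet_Ioo).compl
  have hκZ : ∀ x ∈ Z, κ x = W x := fun x hx => by
    have := eq_zero_of_setIntegral_Iic_notMem_Ioo hρ.continuous h0 hi h1 hx
    simp [hκdef, hWdef, this, klFun]
  have hdisj : ∀ k, Disjoint (Icc (α k) (β k)) Z := fun k =>
    disjoint_left.2 fun x hx hx' => hx' (hsub k x hx)
  have hcover : AECover volume atTop fun k : ℕ => Icc (α k) (β k) ∪ Z := by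
    refine ⟨ae_of_all _ fun x => ?_, fun k => measurableSet_Icc.union hZm⟩
    by_cases hx : F x ∈ Ioo (0 : ℝ) 1
    · have e1 := (tendsto_normalCDF_atBot.comp (tendsto_neg_atTop_atBot.comp
        (tendsto_natCast_atTop_atTop (R := ℝ)))).eventually (gt_mem_nhds hx.1)
      have e2 := (tendsto_normalCDF_atTop.comp
        (tendsto_natCast_atTop_atTop (R := ℝ))).eventually (lt_mem_nhds hx.2)
      filter_upwards [e1, e2] with k hk1 hk2
      refine Or.inl ⟨(hFm.reflect_lt ?_).le, (hFm.reflect_lt ?_).le⟩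
      · rw [hα]; exact hk1
      · rw [hβ]; exact hk2
    · exact Eventually.of_forall fun k => Or.inr hx
  set C := ((∫ x, logDeriv ρ x ^ 2 * ρ x) + 1) / 2
  set B : ℕ → ℝ := fun k => C * (k * √(1 - normalCDF k)) + C * (k * √(normalCDF (-k)))
  have hB : Tendsto B atTop (𝓝 0) := by
    simpa using (tendsto_mul_sqrt_one_sub_normalCDF.const_mul C).add
      (tendsto_mul_sqrt_normalCDF_neg.const_mul C)
  have hq : ∀ k, ρ (β k) * normalTransport ρ (β k) - ρ (α k) * normalTransport ρ (α k) ≤ B k := by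
    intro k
    have t1 : normalTransport ρ (β k) = k := by
      rw [normalTransport]; exact (congrArg _ (hβ k)).trans (normalQuantile_normalCDF _)
    have t2 : normalTransport ρ (α k) = -k := by
      rw [normalTransport]; exact (congrArg _ (hα k)).trans (normalQuantile_normalCDF _)
    have i1 : ∫ t in Ioi (β k), ρ t = 1 - normalCDF k := by
      rw [← hβ k, hFdef]; simp only; rw [setIntegral_Iic_eq_sub hi, h1]; ring
    have b1 := le_sqrt_setIntegral_Ioi hρ h0 hi hσ (x := β k)
      (by rw [i1]; exact sub_pos.2 (normalCDF_mem_Ioo _).2)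
    have i2 : ∫ t in Iic (α k), ρ t = normalCDF (-k) := hα k
    have b2 := le_sqrt_setIntegral_Iic hρ h0 hi hσ (x := α k)
      (by rw [i2]; exact (normalCDF_mem_Ioo _).1)
    rw [i1] at b1
    rw [i2] at b2
    change ρ (β k) ≤ C * _ at b1
    change ρ (α k) ≤ C * _ at b2
    have c1 := mul_le_mul_of_nonneg_right b1 k.cast_nonneg
    have c2 := mul_le_mul_of_nonneg_right b2 k.cast_nonneg
    rw [t1, t2]
    simp only [B]
    linarith
  -- For k = 0 both endpoints are arbitrary preimages of the same value, so their order is unknown.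
  have hαβ : ∀ k, 0 < k → α k ≤ β k := fun k hk => by
    refine (hFm.reflect_lt ?_).le
    rw [hα, hβ]
    exact strictMono_normalCDF (by have : (0 : ℝ) < k := Nat.cast_pos.2 hk; linarith)
  have hκI : ∀ k, IntegrableOn κ (Icc (α k) (β k)) := fun k =>
    hκc.continuousOn.integrableOn_compact isCompact_Icc
  have hκZi : IntegrableOn κ Z := hW.integrableOn.congr_fun (fun x hx => (hκZ x hx).symm) hZm
  have hreal : ∀ k, 0 < k → ∫ x in Icc (α k) (β k) ∪ Z, κ x ≤
      (∫ x in Icc (α k) (β k) ∪ Z, W x) + a * B k := by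
    intro k hk
    rw [setIntegral_union (hdisj k) hZm (hκI k) hκZi,
      setIntegral_union (hdisj k) hZm hW.integrableOn hW.integrableOn,
      setIntegral_congr_fun hZm hκZ]
    have := setIntegral_Icc_klFun_le hρ h0 hi ha hW (fun x => rfl) (hαβ k hk) (hsub k)
    have := mul_le_mul_of_nonneg_left (hq k) ha.le
    linarith
  have hlim : Tendsto (fun k => (∫ x in Icc (α k) (β k) ∪ Z, W x) + a * B k)
      atTop (𝓝 (∫ x, W x)) := by
    simpa using (hcover.integral_tendsto_of_countably_generated hW).add (hB.const_mul a)
  rw [← hWint]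
  constructor
  · refine ge_of_tendsto hlim ((eventually_gt_atTop 0).mono fun k hk => ?_)
    exact (integral_nonneg hκ0).trans (hreal k hk)
  · refine le_of_tendsto_of_tendsto (hcover.lintegral_tendsto_of_countably_generated
      hκc.measurable.ennreal_ofReal.aemeasurable)
      ((ENNReal.continuous_ofReal.tendsto _).comp hlim)
      ((eventually_gt_atTop 0).mono fun k hk => ?_)
    beta_reduce
    rw [← ofReal_integral_eq_lintegral_ofReal ((hκI k).union hκZi) (ae_of_all _ hκ0)]
    exact ENNReal.ofReal_le_ofReal (hreal k hk)

/-- The constant 1 + log a has no definite sign; writing it as b₁ - b₂ with both terms nonnegative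
keeps the inequality free of subtraction in `ℝ≥0∞`. No moment hypothesis is needed: if the right
side is infinite there is nothing to prove, and otherwise both moments are finite because a > 0. -/
theorem lintegral_klFun_le {ρ : ℝ → ℝ} (hρ : ContDiff ℝ 1 ρ) (h0 : ∀ x, 0 ≤ ρ x)
    (h1 : ∫⁻ x, ENNReal.ofReal (ρ x) = 1) {a b₁ b₂ : ℝ} (ha : 0 < a) (hb₁ : 0 ≤ b₁) (hb₂ : 0 ≤ b₂)
    (hb : b₁ - b₂ = 1 + Real.log a) :
    (∫⁻ x, ENNReal.ofReal (normalPDF x * klFun (ρ x / normalPDF x))) + ENNReal.ofReal b₁ ≤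
      (∫⁻ x, ENNReal.ofReal ((x ^ 2 / 2 + a ^ 2 / 2 * logDeriv ρ x ^ 2) * ρ x))
        + ENNReal.ofReal b₂ := by
  set g : ℝ → ℝ := fun x => (x ^ 2 / 2 + a ^ 2 / 2 * logDeriv ρ x ^ 2) * ρ x
  have hlm : Measurable (logDeriv ρ) :=
    (hρ.continuous_deriv le_rfl).measurable.div hρ.continuous.measurable
  have hgm : Measurable g := by
    have := hρ.continuous.measurable
    fun_prop
  have hg0 : ∀ x, 0 ≤ g x := fun x => mul_nonneg (by positivity) (h0 x)
  by_cases htop : ∫⁻ x, ENNReal.ofReal (g x) = ⊤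
  · have htop' := htop
    simp only [g] at htop'
    rw [htop', top_add]
    exact le_top
  have hgi : Integrable g := (lintegral_ofReal_ne_top_iff_integrable hgm.aestronglyMeasurable
    (ae_of_all _ hg0)).1 htop
  have hi : Integrable ρ := (lintegral_ofReal_ne_top_iff_integrable
    hρ.continuous.aestronglyMeasurable (ae_of_all _ h0)).1 (by simp [h1])
  have hi1 : ∫ x, ρ x = 1 := by
    rw [integral_eq_lintegral_of_nonneg_ae (ae_of_all _ h0) hρ.continuous.aestronglyMeasurable, h1]
    rfl
  have hm : Integrable fun x => x ^ 2 * ρ x := by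
    refine (hgi.const_mul 2).mono' (by have := hρ.continuous; fun_prop) (ae_of_all _ fun x => ?_)
    rw [Real.norm_of_nonneg (mul_nonneg (sq_nonneg _) (h0 x))]
    have := mul_nonneg (mul_nonneg (sq_nonneg a) (sq_nonneg (logDeriv ρ x))) (h0 x)
    simp only [g]
    linarith
  have hσ : Integrable fun x => logDeriv ρ x ^ 2 * ρ x := by
    refine (hgi.const_mul (2 / a ^ 2)).mono'
      ((hlm.pow_const 2).mul hρ.continuous.measurable).aestronglyMeasurable (ae_of_all _ fun x => ?_)
    rw [Real.norm_of_nonneg (mul_nonneg (sq_nonneg _) (h0 x))]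
    have h2 := mul_nonneg (div_nonneg (sq_nonneg x) (sq_nonneg a)) (h0 x)
    have h3 : 2 / a ^ 2 * g x = x ^ 2 / a ^ 2 * ρ x + logDeriv ρ x ^ 2 * ρ x := by
      simp only [g]; field_simp
    linarith
  obtain ⟨hX, hle⟩ := lintegral_klFun_le_of_integrable hρ h0 hi hi1 hσ hm ha
  have hgint : ∫ x, g x = a ^ 2 / 2 * (∫ x, logDeriv ρ x ^ 2 * ρ x) + (∫ x, x ^ 2 * ρ x) / 2 := by
    rw [← integral_const_mul, ← integral_div, ← integral_add (hσ.const_mul _) (hm.div_const _)]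
    congr 1
    ext x
    simp only [g]
    ring
  change _ ≤ (∫⁻ x, ENNReal.ofReal (g x)) + _
  rw [← ofReal_integral_eq_lintegral_ofReal hgi (ae_of_all _ hg0), hgint]
  refine (add_le_add_left hle _).trans ?_
  rw [← ENNReal.ofReal_add hX hb₁, ← ENNReal.ofReal_add (hgint ▸ integral_nonneg hg0) hb₂]
  exact ENNReal.ofReal_le_ofReal (by linarith)

lemma lintegral_gaussianReal (h : ℝ → ℝ≥0∞) :
    ∫⁻ x, h x ∂(gaussianReal 0 1) = ∫⁻ x, ENNReal.ofReal (normalPDF x) * h x := by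
  rw [gaussianReal_of_var_ne_zero _ one_ne_zero,
    lintegral_withDensity_eq_lintegral_mul_non_measurable _ (measurable_gaussianPDF 0 1)
    (ae_of_all _ fun _ => gaussianPDF_lt_top)]
  rfl

/-- The integrand of the Kullback-Leibler divergence between two measures with densities
`u` and `v`. -/
noncomputable def klDensity (u v : ℝ≥0∞) : ℝ≥0∞ := v * ENNReal.ofReal (klFun (u / v).toReal)

/-- Both sides are homogeneous of degree one in (ρ, c), and `logDeriv` is unchanged by scaling, so
the probability case suffices. Arbitrary mass is needed for the restrictions of a density to lines.
-/
theorem lintegral_klDensity_le {ρ : ℝ → ℝ} (hρ : ContDiff ℝ 1 ρ) (h0 : ∀ x, 0 ≤ ρ x)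
    {c : ℝ≥0∞} (hc : ∫⁻ x, ENNReal.ofReal (ρ x) = c) (hctop : c ≠ ⊤) {a b₁ b₂ : ℝ} (ha : 0 < a)
    (hb₁ : 0 ≤ b₁) (hb₂ : 0 ≤ b₂) (hb : b₁ - b₂ = 1 + Real.log a) :
    ∫⁻ x, klDensity (ENNReal.ofReal (ρ x / normalPDF x)) c ∂(gaussianReal 0 1)
        + ENNReal.ofReal b₁ * c ≤
      ∫⁻ x, ENNReal.ofReal (x ^ 2 / 2 + a ^ 2 / 2 * logDeriv ρ x ^ 2) *
        ENNReal.ofReal (ρ x / normalPDF x) ∂(gaussianReal 0 1) + ENNReal.ofReal b₂ * c := by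
  rcases eq_or_ne c 0 with rfl | hc0
  · simp [klDensity]
  lift c to NNReal using hctop
  have hc0' : (0 : ℝ) < c := NNReal.coe_pos.2 (pos_iff_ne_zero.2 (by simpa using hc0))
  have hcr : (c : ℝ≥0∞) = ENNReal.ofReal c := by simp
  set ρ' : ℝ → ℝ := fun x => (c : ℝ)⁻¹ * ρ x
  have hsc : ∀ x, ENNReal.ofReal (ρ' x) = (c : ℝ≥0∞)⁻¹ * ENNReal.ofReal (ρ x) := fun x => by
    rw [ENNReal.ofReal_mul (by positivity), ENNReal.ofReal_inv_of_pos hc0', hcr]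
  have h1 : ∫⁻ x, ENNReal.ofReal (ρ' x) = 1 := by
    simp_rw [hsc]
    rw [lintegral_const_mul' _ _ (by simpa using hc0), hc, ENNReal.inv_mul_cancel hc0 (by simp)]
  have key := lintegral_klFun_le (ρ := ρ') (contDiff_const.mul hρ)
    (fun x => mul_nonneg (by positivity) (h0 x)) h1 ha hb₁ hb₂ hb
  have key2 := mul_le_mul_right key (c : ℝ≥0∞)
  rw [mul_add, mul_add, ← lintegral_const_mul' _ _ (by simp),
    ← lintegral_const_mul' _ _ (by simp)] at key2
  rw [lintegral_gaussianReal, lintegral_gaussianReal, mul_comm _ (c : ℝ≥0∞),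
    mul_comm (ENNReal.ofReal b₂)]
  convert key2 using 4 with x x
  · have hφ := normalPDF_pos x
    rw [klDensity, ENNReal.ofReal_mul hφ.le, ← mul_assoc, mul_comm _ (c : ℝ≥0∞), mul_assoc]
    congr 4
    rw [ENNReal.toReal_div, ENNReal.toReal_ofReal (div_nonneg (h0 x) hφ.le)]
    simp only [ρ', ENNReal.coe_toReal]
    field_simp
  · have hφ := normalPDF_pos x
    have hl : logDeriv ρ' x = logDeriv ρ x := logDeriv_const_mul x _ (by positivity)
    rw [hl, ← ENNReal.ofReal_mul (by positivity), ← ENNReal.ofReal_mul hφ.le, hcr,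
      ← ENNReal.ofReal_mul hc0'.le]
    congr 1
    simp only [ρ']
    field_simp

end LineInequality

/-! ### The integrand of the Kullback-Leibler divergence -/

section KLDensity

lemma klDensity_zero_left (v : ℝ≥0∞) : klDensity 0 v = v := by simp [klDensity, klFun]

lemma klDensity_ofReal {u v : ℝ} (hu : 0 < u) (hv : 0 < v) :
    klDensity (ENNReal.ofReal u) (ENNReal.ofReal v) =
      ENNReal.ofReal (u * Real.log u - u * Real.log v + v - u) := by
  rw [klDensity, ← ENNReal.ofReal_div_of_pos hv, ENNReal.toReal_ofReal (by positivity),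
    ← ENNReal.ofReal_mul hv.le, klFun, Real.log_div hu.ne' hv.ne']
  congr 1
  linear_combination (Real.log u - Real.log v - 1) * mul_div_cancel₀ u hv.ne'

lemma klDensity_ofReal_nonneg {u v : ℝ} (hu : 0 < u) (hv : 0 < v) :
    0 ≤ u * Real.log u - u * Real.log v + v - u := by
  have h := mul_nonneg hv.le (klFun_nonneg (div_pos hu hv).le)
  rw [klFun, Real.log_div hu.ne' hv.ne'] at h
  linear_combination h + (Real.log u - Real.log v - 1) * mul_div_cancel₀ u hv.ne'

lemma exists_ofReal_pos {u : ℝ≥0∞} (h0 : u ≠ 0) (ht : u ≠ ⊤) :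
    ∃ x : ℝ, 0 < x ∧ u = ENNReal.ofReal x :=
  ⟨u.toReal, ENNReal.toReal_pos h0 ht, (ENNReal.ofReal_toReal ht).symm⟩

/-- This is log x ≤ x - 1 at x = vw/(zu), multiplied by u and rearranged so that no term is
subtracted. -/
lemma klDensity_add_le {u v w z : ℝ≥0∞} (hu : u ≠ ⊤) (hv : v ≠ ⊤) (hw : w ≠ ⊤) (hz : z ≠ ⊤)
    (hv0 : u ≠ 0 → v ≠ 0) (hw0 : u ≠ 0 → w ≠ 0) (hz0 : u ≠ 0 → z ≠ 0) :
    klDensity u z + (v + w) ≤ klDensity u v + klDensity u w + (v / z * w + z) := by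
  rcases eq_or_ne u 0 with rfl | h0
  · simp only [klDensity_zero_left]
    rw [add_comm]
    gcongr
    exact le_add_self
  obtain ⟨u, hu', rfl⟩ := exists_ofReal_pos h0 hu
  obtain ⟨v, hv', rfl⟩ := exists_ofReal_pos (hv0 h0) hv
  obtain ⟨w, hw', rfl⟩ := exists_ofReal_pos (hw0 h0) hw
  obtain ⟨z, hz', rfl⟩ := exists_ofReal_pos (hz0 h0) hz
  have k1 := klDensity_ofReal_nonneg hu' hz'
  have k2 := klDensity_ofReal_nonneg hu' hv'
  have k3 := klDensity_ofReal_nonneg hu' hw'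
  rw [klDensity_ofReal hu' hv', klDensity_ofReal hu' hw', klDensity_ofReal hu' hz',
    ← ENNReal.ofReal_div_of_pos hz', ← ENNReal.ofReal_mul (by positivity),
    ← ENNReal.ofReal_add hv'.le hw'.le, ← ENNReal.ofReal_add k1 (by positivity),
    ← ENNReal.ofReal_add k2 k3, ← ENNReal.ofReal_add (by positivity) hz'.le,
    ← ENNReal.ofReal_add (by positivity) (by positivity)]
  refine ENNReal.ofReal_le_ofReal ?_
  have h := Real.log_le_sub_one_of_pos (show 0 < v / z * w / u by positivity)
  rw [Real.log_div (by positivity) (by positivity), Real.log_mul (by positivity) (by positivity),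
    Real.log_div (by positivity) (by positivity)] at h
  have h2 := mul_le_mul_of_nonneg_left h hu'.le
  have h3 : u * (v / z * w / u - 1) = v / z * w - u := by field_simp
  linarith

/-- Fenchel duality ut ≤ u log(u/v) - u + v exp t, with t split into positive and negative parts. -/
lemma young_klDensity {u v : ℝ≥0∞} (hu : u ≠ ⊤) (hv : v ≠ ⊤) (hv0 : u ≠ 0 → v ≠ 0) (t : ℝ) :
    u * ENNReal.ofReal t + v ≤
      klDensity u v + (u * ENNReal.ofReal (-t) + v * ENNReal.ofReal (Real.exp t)) := by
  rcases eq_or_ne u 0 with rfl | h0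
  · simp [klDensity_zero_left]
  obtain ⟨u, hu', rfl⟩ := exists_ofReal_pos h0 hu
  obtain ⟨v, hv', rfl⟩ := exists_ofReal_pos (hv0 h0) hv
  have k1 := klDensity_ofReal_nonneg hu' hv'
  rw [klDensity_ofReal hu' hv', ← ENNReal.ofReal_mul hu'.le, ← ENNReal.ofReal_mul hu'.le,
    ← ENNReal.ofReal_mul hv'.le]
  have h := Real.log_le_sub_one_of_pos (show 0 < v * Real.exp t / u by positivity)
  rw [Real.log_div (by positivity) (by positivity), Real.log_mul (by positivity) (by positivity),
    Real.log_exp] at h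
  have h2 := mul_le_mul_of_nonneg_left h hu'.le
  have h3 : u * (v * Real.exp t / u - 1) = v * Real.exp t - u := by field_simp
  rcases le_total 0 t with ht | ht
  · rw [ENNReal.ofReal_of_nonpos (show u * -t ≤ 0 by nlinarith), zero_add,
      ← ENNReal.ofReal_add (by positivity) hv'.le, ← ENNReal.ofReal_add k1 (by positivity)]
    exact ENNReal.ofReal_le_ofReal (by linarith)
  · rw [ENNReal.ofReal_of_nonpos (show u * t ≤ 0 by nlinarith), zero_add,
      ← ENNReal.ofReal_add (by nlinarith) (by positivity), ← ENNReal.ofReal_add k1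
        (add_nonneg (by nlinarith) (by positivity))]
    exact ENNReal.ofReal_le_ofReal (by linarith)

theorem klDiv_withDensity {α : Type*} [MeasurableSpace α] {μ : Measure α} [SigmaFinite μ]
    {f g : α → ℝ≥0∞} (hf : Measurable f) (hg : Measurable g) (hfi : ∫⁻ x, f x ∂μ ≠ ⊤)
    (hgi : ∫⁻ x, g x ∂μ ≠ ⊤) (hfg : ∀ᵐ x ∂μ, f x ≠ 0 → g x ≠ 0) :
    klDiv (μ.withDensity f) (μ.withDensity g) = ∫⁻ x, klDensity (f x) (g x) ∂μ := by
  have := isFiniteMeasure_withDensity hfi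
  have := isFiniteMeasure_withDensity hgi
  have hgt := ae_lt_top hg hgi
  have heq : μ.withDensity f = (μ.withDensity g).withDensity (fun x => f x / g x) := by
    refine Eq.trans ?_ (withDensity_mul μ hg (hf.div hg))
    refine withDensity_congr_ae ?_
    filter_upwards [hfg, hgt] with x h1 h2
    by_cases h : f x = 0
    · simp [h]
    · exact (ENNReal.mul_div_cancel (h1 h) h2.ne).symm
  have hac : μ.withDensity f ≪ μ.withDensity g := by
    rw [heq]; exact withDensity_absolutelyContinuous _ _
  have hr : (μ.withDensity f).rnDeriv (μ.withDensity g) =ᵐ[μ.withDensity g]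
      fun x => f x / g x := by
    rw [heq]; exact Measure.rnDeriv_withDensity _ (hf.div hg)
  rw [klDiv_eq_lintegral_klFun_of_ac hac]
  have h2 : ∫⁻ x, ENNReal.ofReal (klFun ((μ.withDensity f).rnDeriv (μ.withDensity g) x).toReal)
      ∂(μ.withDensity g) = ∫⁻ x, ENNReal.ofReal (klFun (f x / g x).toReal) ∂(μ.withDensity g) :=
    lintegral_congr_ae (hr.mono fun x hx => by simp only [hx])
  rw [h2]
  exact lintegral_withDensity_eq_lintegral_mul _ hg
    (measurable_klFun.comp (hf.div hg).ennreal_toReal).ennreal_ofReal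

end KLDensity

/-! ### Averaging over coordinates and subadditivity of entropy -/

section Marginal

variable {ι : Type*} [DecidableEq ι] {X : ι → Type*} [∀ i, MeasurableSpace (X i)]
  {μ : ∀ i, Measure (X i)}
  {s : Finset ι} {f g : (∀ i, X i) → ℝ≥0∞}

open Function

lemma lmarginal_mul_left (hf : Measurable f) (hg : ∀ x y, (∀ i ∉ s, x i = y i) → g x = g y)
    (x : ∀ i, X i) :
    (∫⋯∫⁻_s, (fun y => g y * f y) ∂μ) x = g x * (∫⋯∫⁻_s, f ∂μ) x := by
  simp only [lmarginal]
  have hm : Measurable fun y => f (updateFinset x s y) := hf.comp measurable_updateFinset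
  rw [← lintegral_const_mul _ hm]
  refine lintegral_congr fun y => ?_
  rw [hg (updateFinset x s y) x fun i hi => by simp [updateFinset, hi]]

variable [∀ i, IsProbabilityMeasure (μ i)]

lemma lmarginal_eq_self (hg : ∀ x y, (∀ i ∉ s, x i = y i) → g x = g y) : ∫⋯∫⁻_s, g ∂μ = g := by
  ext x
  have h := lmarginal_mul_left (μ := μ) (f := fun _ => 1) measurable_const hg x
  simp only [mul_one] at h
  rw [h]
  simp [lmarginal]

lemma lmarginal_lmarginal_self : ∫⋯∫⁻_s, ∫⋯∫⁻_s, f ∂μ ∂μ = ∫⋯∫⁻_s, f ∂μ :=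
  lmarginal_eq_self fun _ _ h => lmarginal_congr μ f h

variable [Fintype ι]

lemma lintegral_lmarginal (hf : Measurable f) (s : Finset ι) :
    ∫⁻ x, (∫⋯∫⁻_s, f ∂μ) x ∂(Measure.pi μ) = ∫⁻ x, f x ∂(Measure.pi μ) :=
  lintegral_eq_of_lmarginal_eq s (hf.lmarginal μ) hf lmarginal_lmarginal_self

/-- The set where the average vanishes does not depend on the coordinates in s, so f has the same
integral over it as its average, namely zero. -/
lemma ae_lmarginal_ne_zero (hf : Measurable f) (s : Finset ι) :
    ∀ᵐ x ∂(Measure.pi μ), f x ≠ 0 → (∫⋯∫⁻_s, f ∂μ) x ≠ 0 := by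
  set A : Set (∀ i, X i) := {x | (∫⋯∫⁻_s, f ∂μ) x = 0}
  have hA : MeasurableSet A := hf.lmarginal μ (measurableSet_singleton 0)
  set h : (∀ i, X i) → ℝ≥0∞ := fun x => A.indicator 1 x * f x
  have hm : Measurable h := (measurable_one.indicator hA).mul hf
  have hz : ∫⁻ x, h x ∂(Measure.pi μ) = 0 := by
    rw [← lintegral_lmarginal hm s, lintegral_eq_zero_iff (hm.lmarginal μ)]
    refine Filter.Eventually.of_forall fun x => ?_
    rw [lmarginal_mul_left hf]
    · by_cases hx : x ∈ A
      · rw [show (∫⋯∫⁻_s, f ∂μ) x = 0 from hx, mul_zero]; rfl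
      · simp [hx]
    · intro x y hxy
      have : x ∈ A ↔ y ∈ A := by
        change _ = _ ↔ _ = _
        rw [lmarginal_congr μ f hxy]
      by_cases hy : y ∈ A
      · simp [hy, this.2 hy]
      · simp [hy, this.not.2 hy]
  rw [lintegral_eq_zero_iff hm] at hz
  filter_upwards [hz] with x hx hf0 hx0
  have : x ∈ A := hx0
  simp [h, this] at hx
  exact hf0 hx

lemma ae_lmarginal_ne_top (hf : Measurable f) (hfi : ∫⁻ x, f x ∂(Measure.pi μ) ≠ ⊤)
    (s : Finset ι) : ∀ᵐ x ∂(Measure.pi μ), (∫⋯∫⁻_s, f ∂μ) x ≠ ⊤ :=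
  (ae_lt_top (hf.lmarginal μ) (by rwa [lintegral_lmarginal hf])).mono fun _ h => h.ne

lemma measurable_klDensity_comp {α : Type*} [MeasurableSpace α] {f g : α → ℝ≥0∞}
    (hf : Measurable f) (hg : Measurable g) : Measurable fun x => klDensity (f x) (g x) :=
  hg.mul (measurable_klFun.comp (hf.div hg).ennreal_toReal).ennreal_ofReal

/-- Subadditivity of the relative entropy: resampling the coordinates in `insert j s` costs at most
the sum of the costs of resampling the coordinate `j` and the coordinates in `s`. -/
lemma lintegral_klDensity_insert_le (hf : Measurable f) (hfi : ∫⁻ x, f x ∂(Measure.pi μ) ≠ ⊤)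
    {j : ι} (hj : j ∉ s) :
    ∫⁻ x, klDensity (f x) ((∫⋯∫⁻_insert j s, f ∂μ) x) ∂(Measure.pi μ) ≤
      ∫⁻ x, klDensity (f x) ((∫⋯∫⁻_{j}, f ∂μ) x) ∂(Measure.pi μ) +
        ∫⁻ x, klDensity (f x) ((∫⋯∫⁻_s, f ∂μ) x) ∂(Measure.pi μ) := by
  set fj := ∫⋯∫⁻_{j}, f ∂μ
  set fs := ∫⋯∫⁻_s, f ∂μ
  set fjs := ∫⋯∫⁻_insert j s, f ∂μ with hfjs
  have mj : Measurable fj := hf.lmarginal μ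
  have ms : Measurable fs := hf.lmarginal μ
  have mjs : Measurable fjs := hf.lmarginal μ
  have mx : Measurable fun x => fj x / fjs x * fs x := (mj.div mjs).mul ms
  have mjs' : Measurable fun x => fj x + fs x := mj.add ms
  have mx' : Measurable fun x => fj x / fjs x * fs x + fjs x := mx.add mjs
  -- Average over j: the quotient does not depend on that coordinate, and fs averages to fjs, which
  -- cancels the denominator. Only ≤ survives, since fjs may be 0 or ⊤.
  have hcross : ∫⁻ x, fj x / fjs x * fs x ∂(Measure.pi μ) ≤ ∫⁻ x, f x ∂(Measure.pi μ) := by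
    rw [← lintegral_lmarginal mx {j}, ← lintegral_lmarginal hf {j}]
    refine lintegral_mono fun x => ?_
    rw [lmarginal_mul_left (g := fun x => fj x / fjs x) ms]
    · have : ∫⋯∫⁻_{j}, fs ∂μ = fjs := by
        rw [hfjs, Finset.insert_eq, lmarginal_union μ f hf (Finset.disjoint_singleton_left.2 hj)]
      rw [this]
      rw [mul_comm]
      exact ENNReal.mul_div_le
    · intro x y hxy
      have h1 : fj x = fj y := lmarginal_congr μ f hxy
      have h2 : fjs x = fjs y := lmarginal_congr μ f fun i hi => hxy i
        (by simp only [Finset.mem_insert, not_or] at hi; simpa using hi.1)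
      simp only [h1, h2]
  have hpt : ∀ᵐ x ∂(Measure.pi μ), klDensity (f x) (fjs x) + (fj x + fs x) ≤
      klDensity (f x) (fj x) + klDensity (f x) (fs x) + (fj x / fjs x * fs x + fjs x) := by
    filter_upwards [ae_lt_top hf hfi, ae_lmarginal_ne_top hf hfi {j}, ae_lmarginal_ne_top hf hfi s,
      ae_lmarginal_ne_top hf hfi (insert j s), ae_lmarginal_ne_zero (μ := μ) hf {j},
      ae_lmarginal_ne_zero (μ := μ) hf s, ae_lmarginal_ne_zero (μ := μ) hf (insert j s)]
      with x h1 h2 h3 h4 h5 h6 h7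
    exact klDensity_add_le h1.ne h2 h3 h4 h5 h6 h7
  have h := lintegral_mono_ae hpt
  rw [lintegral_add_right _ mjs', lintegral_add_right _ ms,
    lintegral_add_right _ mx', lintegral_add_right _ mjs,
    lintegral_add_right _ (measurable_klDensity_comp hf ms), lintegral_lmarginal hf,
    lintegral_lmarginal hf, lintegral_lmarginal hf] at h
  have h2 := h.trans (add_le_add_right (add_le_add_left hcross _) _)
  exact (ENNReal.add_le_add_iff_right (ENNReal.add_ne_top.2 ⟨hfi, hfi⟩)).1 h2

lemma lintegral_klDensity_self {α : Type*} [MeasurableSpace α] {μ : Measure α} {f : α → ℝ≥0∞}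
    (hf : Measurable f) (hfi : ∫⁻ x, f x ∂μ ≠ ⊤) : ∫⁻ x, klDensity (f x) (f x) ∂μ = 0 := by
  rw [lintegral_eq_zero_iff (measurable_klDensity_comp hf hf)]
  filter_upwards [ae_lt_top hf hfi] with x hx
  rcases eq_or_ne (f x) 0 with h | h
  · simp [h, klDensity]
  · simp [klDensity, ENNReal.div_self h hx.ne, klFun]

theorem lintegral_klDensity_lmarginal_le_sum (hf : Measurable f)
    (hfi : ∫⁻ x, f x ∂(Measure.pi μ) ≠ ⊤) (s : Finset ι) :
    ∫⁻ x, klDensity (f x) ((∫⋯∫⁻_s, f ∂μ) x) ∂(Measure.pi μ) ≤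
      ∑ j ∈ s, ∫⁻ x, klDensity (f x) ((∫⋯∫⁻_{j}, f ∂μ) x) ∂(Measure.pi μ) := by
  induction s using Finset.induction_on with
  | empty => simp [lintegral_klDensity_self hf hfi]
  | insert j s hj ih =>
    rw [Finset.sum_insert hj]
    exact (lintegral_klDensity_insert_le hf hfi hj).trans (by gcongr)

end Marginal

/-! ### Dimensional logarithmic Sobolev inequality for the Gaussian product -/

section GaussianProduct

open Function Finset

lemma lmarginal_prod {ι : Type*} [DecidableEq ι] {X : ι → Type*} [∀ i, MeasurableSpace (X i)]
    {μ : ∀ i, Measure (X i)} [∀ i, SigmaFinite (μ i)] {f : ∀ i, X i → ℝ≥0∞}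
    (hf : ∀ i, Measurable (f i)) (s : Finset ι) (x : ∀ i, X i) :
    (∫⋯∫⁻_s, (fun y => ∏ i ∈ s, f i (y i)) ∂μ) x = ∏ i ∈ s, ∫⁻ t, f i t ∂(μ i) := by
  have hm : ∀ s : Finset ι, Measurable fun y : ∀ i, X i => ∏ i ∈ s, f i (y i) := fun s =>
    Finset.measurable_prod s fun i _ => (hf i).comp (measurable_pi_apply i)
  induction s using Finset.induction_on generalizing x with
  | empty => simp
  | insert j s hj ih =>
    rw [lmarginal_insert _ (hm _) hj, Finset.prod_insert hj, ← lintegral_mul_const _ (hf j)]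
    refine lintegral_congr fun t => ?_
    simp_rw [Finset.prod_insert hj]
    rw [lmarginal_mul_left (hm s) (fun x y hxy => by rw [hxy j hj]), ih, update_self]

lemma lintegral_pi_prod {ι : Type*} [Fintype ι] {X : ι → Type*} [∀ i, MeasurableSpace (X i)]
    {μ : ∀ i, Measure (X i)} [∀ i, SigmaFinite (μ i)] {f : ∀ i, X i → ℝ≥0∞}
    (hf : ∀ i, Measurable (f i)) :
    ∫⁻ x, ∏ i, f i (x i) ∂(Measure.pi μ) = ∏ i, ∫⁻ t, f i t ∂(μ i) := by
  classical
  rcases isEmpty_or_nonempty (∀ i, X i) with h | ⟨⟨x⟩⟩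
  · obtain ⟨i, hi⟩ : ∃ i, IsEmpty (X i) := by simpa using h
    rw [lintegral_of_isEmpty, Finset.prod_eq_zero (Finset.mem_univ i) (lintegral_of_isEmpty _ _)]
  · rw [lintegral_eq_lmarginal_univ x, lmarginal_prod hf]

variable {ι : Type*} [Fintype ι]

/-- The density of the standard normal law on `ι → ℝ`. -/
noncomputable def normalPDFPi (y : ι → ℝ) : ℝ := ∏ i, normalPDF (y i)

/-- The standard normal law on `ι → ℝ`. -/
noncomputable abbrev normalPi (ι : Type*) [Fintype ι] : Measure (ι → ℝ) :=
  Measure.pi fun _ => gaussianReal 0 1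

lemma normalPDFPi_pos (y : ι → ℝ) : 0 < normalPDFPi y :=
  Finset.prod_pos fun i _ => normalPDF_pos (y i)

lemma continuous_normalPDFPi : Continuous (normalPDFPi : (ι → ℝ) → ℝ) :=
  continuous_finsetProd _ fun i _ => continuous_normalPDF.comp (continuous_apply i)

lemma normalPi_eq_withDensity :
    normalPi ι = volume.withDensity fun y => ENNReal.ofReal (normalPDFPi y) := by
  refine Measure.pi_eq fun s hs => ?_
  rw [withDensity_apply _ (MeasurableSet.univ_pi hs),
    ← lintegral_indicator (MeasurableSet.univ_pi hs)]
  have hm : ∀ i, Measurable ((s i).indicator fun t => ENNReal.ofReal (normalPDF t)) := fun i =>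
    (continuous_normalPDF.measurable.ennreal_ofReal).indicator (hs i)
  have h : ∀ i, gaussianReal 0 1 (s i) =
      ∫⁻ t, (s i).indicator (fun t => ENNReal.ofReal (normalPDF t)) t := fun i => by
    rw [lintegral_indicator (hs i), gaussianReal_apply _ one_ne_zero]
    rfl
  simp_rw [h]
  rw [← lintegral_pi_prod hm, ← volume_pi]
  refine lintegral_congr fun y => ?_
  by_cases hy : y ∈ Set.univ.pi s
  · rw [Set.indicator_of_mem hy, normalPDFPi, ENNReal.ofReal_prod_of_nonneg
      fun i _ => (normalPDF_pos _).le]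
    exact Finset.prod_congr rfl fun i _ => by
      rw [Set.indicator_of_mem (hy i trivial)]
  · rw [Set.indicator_of_notMem hy]
    obtain ⟨i, hi⟩ : ∃ i, y i ∉ s i := by simpa [Set.mem_pi] using hy
    exact (Finset.prod_eq_zero (Finset.mem_univ i) (Set.indicator_of_notMem hi _)).symm

/-- The density with respect to the standard normal law of the measure with Lebesgue
density `q`. -/
noncomputable def gaussDensity (q : (ι → ℝ) → ℝ) (y : ι → ℝ) : ℝ≥0∞ :=
  ENNReal.ofReal (q y / normalPDFPi y)

lemma measurable_gaussDensity {q : (ι → ℝ) → ℝ} (hq : Measurable q) :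
    Measurable (gaussDensity q) :=
  (hq.div continuous_normalPDFPi.measurable).ennreal_ofReal

lemma withDensity_gaussDensity {q : (ι → ℝ) → ℝ} (hq : Measurable q) :
    (normalPi ι).withDensity (gaussDensity q) =
      volume.withDensity fun y => ENNReal.ofReal (q y) := by
  rw [normalPi_eq_withDensity, ← withDensity_mul _
    continuous_normalPDFPi.measurable.ennreal_ofReal (measurable_gaussDensity hq)]
  congr 1
  ext y
  have h := normalPDFPi_pos y
  rw [Pi.mul_apply, gaussDensity, ← ENNReal.ofReal_mul h.le, mul_div_cancel₀ _ h.ne']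

variable [DecidableEq ι]

/-- The partial logarithmic derivative of `q` in the coordinate `j`. -/
noncomputable def partialScore (q : (ι → ℝ) → ℝ) (j : ι) (y : ι → ℝ) : ℝ :=
  fderiv ℝ q y (Pi.single j 1) / q y

lemma measurable_partialScore {q : (ι → ℝ) → ℝ} (hq : ContDiff ℝ 1 q) (j : ι) :
    Measurable (partialScore q j) :=
  ((hq.continuous_fderiv one_ne_zero).clm_apply continuous_const).measurable.div
    hq.continuous.measurable

lemma normalPDFPi_update (y : ι → ℝ) (j : ι) (t : ℝ) :
    normalPDFPi (update y j t) = normalPDF t * ∏ i ∈ univ.erase j, normalPDF (y i) := by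
  rw [normalPDFPi, ← Finset.mul_prod_erase _ _ (Finset.mem_univ j), update_self]
  congr 1
  exact Finset.prod_congr rfl fun i hi => by rw [update_of_ne (Finset.ne_of_mem_erase hi)]

/-- The line inequality on the line through y in direction j. Dividing q by the normal densities K
of the other coordinates gives a ρ for which `gaussDensity` is ρ over the one-dimensional normal
density. -/
lemma lmarginal_singleton_klDensity_le {q : (ι → ℝ) → ℝ} (hq : ContDiff ℝ 1 q)
    (hq0 : ∀ y, 0 ≤ q y) (j : ι) {a b₁ b₂ : ℝ} (ha : 0 < a)
    (hb₁ : 0 ≤ b₁) (hb₂ : 0 ≤ b₂) (hb : b₁ - b₂ = 1 + Real.log a) (y : ι → ℝ)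
    (hy : (∫⋯∫⁻_{j}, gaussDensity q ∂fun _ => gaussianReal 0 1) y ≠ ⊤) :
    (∫⋯∫⁻_{j}, (fun z => klDensity (gaussDensity q z)
        ((∫⋯∫⁻_{j}, gaussDensity q ∂fun _ => gaussianReal 0 1) z)) ∂fun _ => gaussianReal 0 1) y
      + ENNReal.ofReal b₁ * (∫⋯∫⁻_{j}, gaussDensity q ∂fun _ => gaussianReal 0 1) y ≤
    (∫⋯∫⁻_{j}, (fun z => ENNReal.ofReal ((z j) ^ 2 / 2 + a ^ 2 / 2 * partialScore q j z ^ 2)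
        * gaussDensity q z) ∂fun _ => gaussianReal 0 1) y
      + ENNReal.ofReal b₂ * (∫⋯∫⁻_{j}, gaussDensity q ∂fun _ => gaussianReal 0 1) y := by
  set K := ∏ i ∈ univ.erase j, normalPDF (y i)
  have hK : 0 < K := Finset.prod_pos fun i _ => normalPDF_pos _
  set ρ : ℝ → ℝ := fun t => q (update y j t) * K⁻¹
  have hρ : ContDiff ℝ 1 ρ := (hq.comp (contDiff_update 1 y j)).mul contDiff_const
  have hρ0 : ∀ t, 0 ≤ ρ t := fun t => mul_nonneg (hq0 _) (by positivity)
  have hg : ∀ t, gaussDensity q (update y j t) = ENNReal.ofReal (ρ t / normalPDF t) := fun t => by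
    rw [gaussDensity, normalPDFPi_update, mul_comm (normalPDF t), div_mul_eq_div_div,
      div_eq_mul_inv _ K]
  have hs : ∀ t, partialScore q j (update y j t) = logDeriv ρ t := fun t => by
    have h1 : HasDerivAt (fun t => q (update y j t))
        (fderiv ℝ q (update y j t) (Pi.single j 1)) t :=
      ((hq.differentiable one_ne_zero _).hasFDerivAt).comp_hasDerivAt t (hasDerivAt_update y j t)
    rw [show ρ = fun t => q (update y j t) * K⁻¹ from rfl,
      logDeriv_mul_const t _ (by positivity), logDeriv_apply, h1.deriv]
    rfl
  have hc : ∫⁻ t, ENNReal.ofReal (ρ t) =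
      (∫⋯∫⁻_{j}, gaussDensity q ∂fun _ => gaussianReal 0 1) y := by
    rw [lmarginal_singleton]
    beta_reduce
    rw [lintegral_gaussianReal]
    refine lintegral_congr fun t => ?_
    have := normalPDF_pos t
    rw [hg, ← ENNReal.ofReal_mul this.le, mul_div_cancel₀ _ this.ne']
  have key := lintegral_klDensity_le hρ hρ0 hc hy ha hb₁ hb₂ hb
  rw [lmarginal_singleton (fun z => klDensity _ _), lmarginal_singleton (fun z => _ * _)]
  simp only [lmarginal_update_of_mem _ (Finset.mem_singleton_self j), hg, hs, update_self]
  exact key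

theorem lintegral_klDensity_singleton_add_le {q : (ι → ℝ) → ℝ} (hq : ContDiff ℝ 1 q)
    (hq0 : ∀ y, 0 ≤ q y) (hq1 : ∫⁻ y, gaussDensity q y ∂(normalPi ι) = 1) (j : ι) {a b₁ b₂ : ℝ}
    (ha : 0 < a) (hb₁ : 0 ≤ b₁) (hb₂ : 0 ≤ b₂) (hb : b₁ - b₂ = 1 + Real.log a) :
    ∫⁻ y, klDensity (gaussDensity q y)
        ((∫⋯∫⁻_{j}, gaussDensity q ∂fun _ => gaussianReal 0 1) y) ∂(normalPi ι)
      + ENNReal.ofReal b₁ ≤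
    ∫⁻ y, ENNReal.ofReal ((y j) ^ 2 / 2 + a ^ 2 / 2 * partialScore q j y ^ 2)
        * gaussDensity q y ∂(normalPi ι) + ENNReal.ofReal b₂ := by
  have hf := measurable_gaussDensity hq.continuous.measurable
  have hfj : Measurable (∫⋯∫⁻_{j}, gaussDensity q ∂fun _ => gaussianReal 0 1) := hf.lmarginal _
  have hk := measurable_klDensity_comp hf hfj
  have hG : Measurable fun y : ι → ℝ => ENNReal.ofReal ((y j) ^ 2 / 2 + a ^ 2 / 2 *
      partialScore q j y ^ 2) * gaussDensity q y := by
    have := measurable_partialScore hq j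
    fun_prop
  have h1 := lintegral_lmarginal (μ := fun _ => gaussianReal 0 1) hf {j}
  rw [hq1] at h1
  rw [← lintegral_lmarginal hk {j}, ← lintegral_lmarginal hG {j},
    ← mul_one (ENNReal.ofReal b₁), ← mul_one (ENNReal.ofReal b₂), ← h1,
    ← lintegral_const_mul _ hfj, ← lintegral_const_mul _ hfj,
    ← lintegral_add_right _ (hfj.const_mul _), ← lintegral_add_right _ (hfj.const_mul _)]
  refine lintegral_mono_ae ?_
  filter_upwards [ae_lmarginal_ne_top (μ := fun _ => gaussianReal 0 1) hf (by rw [hq1]; simp) {j}]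
    with y hy
  exact lmarginal_singleton_klDensity_le hq hq0 j ha hb₁ hb₂ hb y hy

theorem lintegral_klDensity_singleton_le {q : (ι → ℝ) → ℝ} (hq : ContDiff ℝ 1 q)
    (hq0 : ∀ y, 0 ≤ q y) (hq1 : ∫⁻ y, gaussDensity q y ∂(normalPi ι) = 1) (j : ι) {m h : ℝ}
    (hm0 : 0 ≤ m) (hh0 : 0 < h)
    (hm : ∫⁻ y, ENNReal.ofReal (y j ^ 2) * gaussDensity q y ∂(normalPi ι) = ENNReal.ofReal m)
    (hh : ∫⁻ y, ENNReal.ofReal (partialScore q j y ^ 2) * gaussDensity q y ∂(normalPi ι) =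
      ENNReal.ofReal h) :
    0 ≤ (m - 1 + Real.log h) / 2 ∧
    ∫⁻ y, klDensity (gaussDensity q y)
        ((∫⋯∫⁻_{j}, gaussDensity q ∂fun _ => gaussianReal 0 1) y) ∂(normalPi ι) ≤
      ENNReal.ofReal ((m - 1 + Real.log h) / 2) := by
  have hf := measurable_gaussDensity hq.continuous.measurable
  -- The minimiser of a²h/2 - log a.
  set a := (√h)⁻¹ with ha
  have ha0 : 0 < a := by positivity
  have hla : Real.log a = -(Real.log h / 2) := by rw [ha, Real.log_inv, Real.log_sqrt hh0.le]
  have hah : a ^ 2 * h = 1 := by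
    rw [ha, inv_pow, Real.sq_sqrt hh0.le, inv_mul_cancel₀ hh0.ne']
  obtain ⟨b₁, b₂, hb₁, hb₂, hb⟩ : ∃ b₁ b₂ : ℝ, 0 ≤ b₁ ∧ 0 ≤ b₂ ∧ b₁ - b₂ = 1 + Real.log a :=
    ⟨(1 + Real.log a)⁺, (1 + Real.log a)⁻, posPart_nonneg _, negPart_nonneg _,
      posPart_sub_negPart _⟩
  have key := lintegral_klDensity_singleton_add_le hq hq0 hq1 j ha0 hb₁ hb₂ hb
  have hR : ∫⁻ y, ENNReal.ofReal ((y j) ^ 2 / 2 + a ^ 2 / 2 * partialScore q j y ^ 2)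
        * gaussDensity q y ∂(normalPi ι) = ENNReal.ofReal (m / 2 + 1 / 2) := by
    have hms := measurable_partialScore hq j
    have e : ∀ y : ι → ℝ, ENNReal.ofReal ((y j) ^ 2 / 2 + a ^ 2 / 2 * partialScore q j y ^ 2)
        * gaussDensity q y = ENNReal.ofReal (1 / 2) * (ENNReal.ofReal (y j ^ 2) * gaussDensity q y)
        + ENNReal.ofReal (a ^ 2 / 2) *
          (ENNReal.ofReal (partialScore q j y ^ 2) * gaussDensity q y) := fun y => by
      rw [ENNReal.ofReal_add (by positivity) (by positivity), add_mul,
        ENNReal.ofReal_mul (by positivity), div_eq_inv_mul, ENNReal.ofReal_mul (by positivity),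
        one_div, mul_assoc, mul_assoc]
    simp_rw [e]
    rw [lintegral_add_right _ (by fun_prop), lintegral_const_mul _ (by fun_prop),
      lintegral_const_mul _ (by fun_prop), hm, hh, ← ENNReal.ofReal_mul (by positivity),
      ← ENNReal.ofReal_mul (by positivity), ← ENNReal.ofReal_add (by positivity) (by positivity)]
    congr 1
    linear_combination hah / 2
  rw [hR, ← ENNReal.ofReal_add (by positivity) hb₂] at key
  have h1 : b₁ ≤ m / 2 + 1 / 2 + b₂ :=
    (ENNReal.ofReal_le_ofReal_iff (by positivity)).1 (le_add_self.trans key)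
  have h2 : m / 2 + 1 / 2 + b₂ - b₁ = (m - 1 + Real.log h) / 2 := by linarith
  refine ⟨by linarith, ?_⟩
  have h3 := ENNReal.le_sub_of_add_le_right ENNReal.ofReal_ne_top key
  rwa [← ENNReal.ofReal_sub _ hb₁, h2] at h3

/-- Dimensional logarithmic Sobolev inequality for the coordinates in `s`. -/
theorem lintegral_klDensity_lmarginal_le {q : (ι → ℝ) → ℝ} (hq : ContDiff ℝ 1 q)
    (hq0 : ∀ y, 0 ≤ q y) (hq1 : ∫⁻ y, gaussDensity q y ∂(normalPi ι) = 1) (s : Finset ι)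
    {m h : ι → ℝ} (hm0 : ∀ j ∈ s, 0 ≤ m j) (hh0 : ∀ j ∈ s, 0 < h j)
    (hm : ∀ j ∈ s, ∫⁻ y, ENNReal.ofReal (y j ^ 2) * gaussDensity q y ∂(normalPi ι) =
      ENNReal.ofReal (m j))
    (hh : ∀ j ∈ s, ∫⁻ y, ENNReal.ofReal (partialScore q j y ^ 2) * gaussDensity q y
      ∂(normalPi ι) = ENNReal.ofReal (h j)) :
    0 ≤ ∑ j ∈ s, (m j - 1 + Real.log (h j)) / 2 ∧
    ∫⁻ y, klDensity (gaussDensity q y)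
        ((∫⋯∫⁻_s, gaussDensity q ∂fun _ => gaussianReal 0 1) y) ∂(normalPi ι) ≤
      ENNReal.ofReal (∑ j ∈ s, (m j - 1 + Real.log (h j)) / 2) := by
  have key := fun j hj =>
    lintegral_klDensity_singleton_le hq hq0 hq1 j (hm0 j hj) (hh0 j hj) (hm j hj) (hh j hj)
  refine ⟨Finset.sum_nonneg fun j hj => (key j hj).1, ?_⟩
  rw [ENNReal.ofReal_sum_of_nonneg fun j hj => (key j hj).1]
  exact (lintegral_klDensity_lmarginal_le_sum (measurable_gaussDensity hq.continuous.measurable)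
    (by rw [hq1]; simp) s).trans (Finset.sum_le_sum fun j hj => (key j hj).2)

end GaussianProduct

/-! ### Lower bound by duality with Gaussian test functions -/

section LowerBound

open Finset

variable {ι : Type*} [Fintype ι] [DecidableEq ι]

/-- The average of f is constant in the coordinates of s, over which the product integrates to one.
-/
lemma lintegral_lmarginal_mul_prod {f : (ι → ℝ) → ℝ≥0∞} (hf : Measurable f) (s : Finset ι)
    {g : ι → ℝ → ℝ≥0∞} (hg : ∀ j, Measurable (g j))
    (hg1 : ∀ j ∈ s, ∫⁻ t, g j t ∂(gaussianReal 0 1) = 1) :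
    ∫⁻ y, (∫⋯∫⁻_s, f ∂fun _ => gaussianReal 0 1) y * ∏ j ∈ s, g j (y j) ∂(normalPi ι) =
      ∫⁻ y, f y ∂(normalPi ι) := by
  have hm : Measurable fun y : ι → ℝ => ∏ j ∈ s, g j (y j) :=
    Finset.measurable_prod s fun j _ => (hg j).comp (measurable_pi_apply j)
  have hfs : Measurable (∫⋯∫⁻_s, f ∂fun _ => gaussianReal 0 1) := hf.lmarginal _
  have hfm : Measurable fun y : ι → ℝ => (∫⋯∫⁻_s, f ∂fun _ => gaussianReal 0 1) y *
      ∏ j ∈ s, g j (y j) := hfs.mul hm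
  rw [← lintegral_lmarginal hfm s, ← lintegral_lmarginal hf s]
  refine lintegral_congr fun y => ?_
  rw [lmarginal_mul_left hm fun x y h => lmarginal_congr _ f h,
    lmarginal_prod hg, Finset.prod_congr rfl hg1, Finset.prod_const_one, mul_one]

/-- Donsker-Varadhan lower bound with a separable test function. -/
theorem ofReal_integral_le_lintegral_klDensity {f : (ι → ℝ) → ℝ≥0∞} (hf : Measurable f)
    (hf1 : ∫⁻ y, f y ∂(normalPi ι) = 1) (s : Finset ι) {F : ι → ℝ → ℝ}
    (hF : ∀ j, Measurable (F j))
    (hF1 : ∀ j ∈ s, ∫⁻ t, ENNReal.ofReal (Real.exp (F j t)) ∂(gaussianReal 0 1) = 1)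
    (hint : Integrable (fun y => ∑ j ∈ s, F j (y j)) ((normalPi ι).withDensity f)) :
    ENNReal.ofReal (∫ y, ∑ j ∈ s, F j (y j) ∂((normalPi ι).withDensity f)) ≤
      ∫⁻ y, klDensity (f y) ((∫⋯∫⁻_s, f ∂fun _ => gaussianReal 0 1) y) ∂(normalPi ι) := by
  set G : (ι → ℝ) → ℝ := fun y => ∑ j ∈ s, F j (y j)
  set fs := ∫⋯∫⁻_s, f ∂fun _ : ι => gaussianReal 0 1
  have hG : Measurable G :=
    Finset.measurable_sum s fun j _ => (hF j).comp (measurable_pi_apply j)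
  have hfs : Measurable fs := hf.lmarginal _
  have hexp : ∫⁻ y, fs y * ENNReal.ofReal (Real.exp (G y)) ∂(normalPi ι) = 1 := by
    have e : ∀ y, ENNReal.ofReal (Real.exp (G y)) =
        ∏ j ∈ s, ENNReal.ofReal (Real.exp (F j (y j))) := fun y => by
      rw [Real.exp_sum, ENNReal.ofReal_prod_of_nonneg fun _ _ => (Real.exp_pos _).le]
    simp_rw [e]
    rw [lintegral_lmarginal_mul_prod (g := fun j t => ENNReal.ofReal (Real.exp (F j t))) hf s
      (fun j => (Real.measurable_exp.comp (hF j)).ennreal_ofReal) hF1, hf1]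
  have hfi : ∫⁻ y, f y ∂(normalPi ι) ≠ ⊤ := by simp [hf1]
  have hpt : ∀ᵐ y ∂(normalPi ι), f y * ENNReal.ofReal (G y) + fs y ≤
      klDensity (f y) (fs y) + (f y * ENNReal.ofReal (-G y) +
        fs y * ENNReal.ofReal (Real.exp (G y))) := by
    filter_upwards [ae_lt_top hf hfi, ae_lmarginal_ne_top hf hfi s,
      ae_lmarginal_ne_zero (μ := fun _ => gaussianReal 0 1) hf s] with y h1 h2 h3
    exact young_klDensity h1.ne h2 h3 _
  have m1 : Measurable fun y => f y * ENNReal.ofReal (G y) := hf.mul hG.ennreal_ofReal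
  have m2 : Measurable fun y => f y * ENNReal.ofReal (-G y) := hf.mul hG.neg.ennreal_ofReal
  have m3 : Measurable fun y => fs y * ENNReal.ofReal (Real.exp (G y)) :=
    hfs.mul (Real.measurable_exp.comp hG).ennreal_ofReal
  have m4 : Measurable fun y => f y * ENNReal.ofReal (-G y) +
        fs y * ENNReal.ofReal (Real.exp (G y)) := m2.add m3
  have h := lintegral_mono_ae hpt
  rw [lintegral_add_right _ hfs, lintegral_add_right _ m4, lintegral_add_right _ m3, hexp,
    lintegral_lmarginal hf, hf1, ← add_assoc] at h
  have h' := (ENNReal.add_le_add_iff_right ENNReal.one_ne_top).1 h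
  have e1 : ∫⁻ y, ENNReal.ofReal (G y) ∂((normalPi ι).withDensity f) =
      ∫⁻ y, f y * ENNReal.ofReal (G y) ∂(normalPi ι) :=
    lintegral_withDensity_eq_lintegral_mul _ hf hG.ennreal_ofReal
  have e2 : ∫⁻ y, ENNReal.ofReal (-G y) ∂((normalPi ι).withDensity f) =
      ∫⁻ y, f y * ENNReal.ofReal (-G y) ∂(normalPi ι) :=
    lintegral_withDensity_eq_lintegral_mul _ hf hG.neg.ennreal_ofReal
  have t1 := hint.lintegral_lt_top
  have t2 := hint.neg.lintegral_lt_top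
  simp only [Pi.neg_apply] at t2
  rw [integral_eq_lintegral_pos_part_sub_lintegral_neg_part hint,
    ENNReal.ofReal_sub _ ENNReal.toReal_nonneg, ENNReal.ofReal_toReal t1.ne,
    ENNReal.ofReal_toReal t2.ne, tsub_le_iff_right]
  change ∫⁻ y, ENNReal.ofReal (G y) ∂_ ≤ _ + ∫⁻ y, ENNReal.ofReal (-G y) ∂_
  rwa [e1, e2]

/-- The logarithm of the density of the normal law with mean `m` and variance `c` with respect to
the standard normal law. -/
noncomputable def logNormalRatio (m c t : ℝ) : ℝ :=
  t ^ 2 / 2 - (t - m) ^ 2 / (2 * c) - Real.log c / 2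

lemma lintegral_exp_logNormalRatio (m : ℝ) {c : ℝ} (hc : 0 < c) :
    ∫⁻ t, ENNReal.ofReal (Real.exp (logNormalRatio m c t)) ∂(gaussianReal 0 1) = 1 := by
  rw [lintegral_gaussianReal]
  have hc' : c.toNNReal ≠ 0 := by simpa using hc
  rw [← lintegral_gaussianPDFReal_eq_one m hc']
  refine lintegral_congr fun t => ?_
  rw [← ENNReal.ofReal_mul (normalPDF_pos t).le]
  congr 1
  have h2 : 0 < 2 * Real.pi := by positivity
  rw [normalPDF_eq, ← Real.exp_add, gaussianPDFReal, Real.coe_toNNReal c hc.le,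
    ← Real.exp_log (show 0 < (√(2 * Real.pi * c))⁻¹ by positivity), ← Real.exp_add, Real.log_inv,
    Real.log_sqrt (by positivity), Real.log_mul h2.ne' hc.ne', logNormalRatio]
  congr 1
  ring

lemma measurable_logNormalRatio (m c : ℝ) : Measurable (logNormalRatio m c) := by
  unfold logNormalRatio
  fun_prop

/-- The test functions are `logNormalRatio` with the mean and variance of each coordinate. Since c
is the second moment about m, the quadratic term (t - m)²/(2c) has mean 1/2, which produces the -1.
-/
theorem ofReal_le_lintegral_klDensity {f : (ι → ℝ) → ℝ≥0∞} (hf : Measurable f)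
    (hf1 : ∫⁻ y, f y ∂(normalPi ι) = 1) (s : Finset ι) {m c v : ι → ℝ} (hc : ∀ j ∈ s, 0 < c j)
    (hi : ∀ j ∈ s, Integrable (fun y => y j ^ 2) ((normalPi ι).withDensity f))
    (hi' : ∀ j ∈ s, Integrable (fun y => (y j - m j) ^ 2) ((normalPi ι).withDensity f))
    (hv : ∀ j ∈ s, ∫ y, y j ^ 2 ∂((normalPi ι).withDensity f) = v j)
    (hc' : ∀ j ∈ s, ∫ y, (y j - m j) ^ 2 ∂((normalPi ι).withDensity f) = c j) :
    ENNReal.ofReal (∑ j ∈ s, (v j - 1 - Real.log (c j)) / 2) ≤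
      ∫⁻ y, klDensity (f y) ((∫⋯∫⁻_s, f ∂fun _ => gaussianReal 0 1) y) ∂(normalPi ι) := by
  have : IsProbabilityMeasure ((normalPi ι).withDensity f) := ⟨by simp [hf1]⟩
  have hij : ∀ j ∈ s, Integrable (fun y : ι → ℝ => logNormalRatio (m j) (c j) (y j))
      ((normalPi ι).withDensity f) := fun j hj =>
    (((hi j hj).div_const _).sub ((hi' j hj).div_const _)).sub (integrable_const _)
  have key := ofReal_integral_le_lintegral_klDensity hf hf1 s
    (fun j => measurable_logNormalRatio (m j) (c j))
    (fun j hj => lintegral_exp_logNormalRatio (m j) (hc j hj)) (integrable_finsetSum s hij)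
  rw [integral_finsetSum s hij] at key
  convert key using 3 with j hj
  have hcj := hc j hj
  have i1 := (hi j hj).div_const 2
  have i2 := (hi' j hj).div_const (2 * c j)
  have i3 : Integrable (fun x : ι → ℝ => x j ^ 2 / 2 - (x j - m j) ^ 2 / (2 * c j))
      ((normalPi ι).withDensity f) := i1.sub i2
  simp only [logNormalRatio]
  rw [integral_sub i3 (integrable_const _), integral_sub i1 i2, integral_div,
    integral_div, hv j hj, hc' j hj]
  simp
  field_simp

end LowerBound

/-! ### Conditional profile and orthonormal coordinates -/

section Transfer

open Finset

/-- Data processing in both directions. -/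
lemma klDiv_map_equiv {α β : Type*} [MeasurableSpace α] [MeasurableSpace β] (e : α ≃ᵐ β)
    (μ ν : Measure α) [IsFiniteMeasure μ] [IsFiniteMeasure ν] :
    klDiv (μ.map e) (ν.map e) = klDiv μ ν := by
  refine le_antisymm (klDiv_map_le μ ν e.measurable) ?_
  have h := klDiv_map_le (μ.map e) (ν.map e) e.symm.measurable
  simpa [Measure.map_map e.symm.measurable e.measurable] using h

lemma map_withDensity_comp {α β : Type*} [MeasurableSpace α] [MeasurableSpace β] (e : α ≃ᵐ β)
    (μ : Measure α) {g : β → ℝ≥0∞} (hg : Measurable g) :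
    (μ.withDensity (fun x => g (e x))).map e = (μ.map e).withDensity g := by
  ext s hs
  rw [Measure.map_apply e.measurable hs, withDensity_apply _ (e.measurable hs),
    withDensity_apply _ hs, setLIntegral_map hs hg e.measurable]

lemma measurable_feature {d r : ℕ} (U : Matrix (Fin d) (Fin r) ℝ) : Measurable (feature U) := by
  have : Continuous (feature U) := by
    unfold feature
    fun_prop
  exact this.measurable

lemma measurable_klProfile {d r : ℕ} (π μ : Measure (EuclideanSpace ℝ (Fin d)))
    [IsFiniteMeasure μ] (U : Matrix (Fin d) (Fin r) ℝ) : Measurable (klProfile π μ U) :=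
  (Measure.measurable_rnDeriv π μ).lintegral_kernel

/-- Disintegration of μ along the feature map. As densities are unique almost everywhere, this
determines the profile without further use of `condDistrib`. -/
lemma withDensity_klProfile {d r : ℕ} (π μ : Measure (EuclideanSpace ℝ (Fin d)))
    [IsFiniteMeasure μ] [IsFiniteMeasure π] (hπ : π ≪ μ) (U : Matrix (Fin d) (Fin r) ℝ) :
    (μ.map (feature U)).withDensity (klProfile π μ U) = π.map (feature U) := by
  have hU := measurable_feature U
  ext B hB
  have hr := Measure.measurable_rnDeriv π μ
  rw [withDensity_apply _ hB, Measure.map_apply hU hB, ← lintegral_indicator hB]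
  have e1 : ∀ θ, B.indicator (klProfile π μ U) θ =
      ∫⁻ x, (B ×ˢ Set.univ).indicator (fun z => π.rnDeriv μ z.2) (θ, x)
        ∂(condDistrib id (feature U) μ θ) := fun θ => by
    by_cases hθ : θ ∈ B
    · rw [Set.indicator_of_mem hθ]
      refine lintegral_congr fun x => ?_
      rw [Set.indicator_of_mem (show (θ, x) ∈ B ×ˢ Set.univ from ⟨hθ, trivial⟩)]
    · rw [Set.indicator_of_notMem hθ]
      refine (lintegral_eq_zero_of_ae_eq_zero (Filter.Eventually.of_forall fun x => ?_)).symm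
      exact Set.indicator_of_notMem (fun h : (θ, x) ∈ B ×ˢ Set.univ => hθ h.1) _
  simp_rw [e1]
  have hm : Measurable ((B ×ˢ (Set.univ : Set (EuclideanSpace ℝ (Fin d)))).indicator
      (fun z => π.rnDeriv μ z.2)) := (hr.comp measurable_snd).indicator (hB.prod .univ)
  have : π.HaveLebesgueDecomposition μ := Measure.haveLebesgueDecomposition_of_sigmaFinite π μ
  have hset : π (feature U ⁻¹' B) = ∫⁻ x in feature U ⁻¹' B, π.rnDeriv μ x ∂μ :=
    (Measure.setLIntegral_rnDeriv hπ _).symm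
  rw [← Measure.lintegral_compProd hm, compProd_map_condDistrib aemeasurable_id,
    lintegral_map hm (hU.prodMk measurable_id), hset, ← lintegral_indicator (hU hB)]
  refine lintegral_congr fun x => ?_
  by_cases hx : feature U x ∈ B
  · rw [Set.indicator_of_mem (show (feature U x, id x) ∈ B ×ˢ Set.univ from ⟨hx, trivial⟩),
      Set.indicator_of_mem (show x ∈ feature U ⁻¹' B from hx)]
    rfl
  · rw [Set.indicator_of_notMem (show (feature U x, id x) ∉ B ×ˢ Set.univ from fun h => hx h.1),
      Set.indicator_of_notMem (show x ∉ feature U ⁻¹' B from hx)]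

variable {ι : Type*} [Fintype ι] {d : ℕ}

/-- The point with coordinates `y` in an orthonormal basis. -/
noncomputable def coordEquiv (b : OrthonormalBasis ι ℝ (EuclideanSpace ℝ (Fin d))) :
    (ι → ℝ) ≃ᵐ EuclideanSpace ℝ (Fin d) :=
  (MeasurableEquiv.toLp 2 (ι → ℝ)).trans b.repr.symm.toHomeomorph.toMeasurableEquiv

lemma coordEquiv_apply (b : OrthonormalBasis ι ℝ (EuclideanSpace ℝ (Fin d))) (y : ι → ℝ) :
    coordEquiv b y = ∑ i, y i • b i :=
  (b.sum_repr_symm (WithLp.toLp 2 y)).symm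

lemma inner_coordEquiv (b : OrthonormalBasis ι ℝ (EuclideanSpace ℝ (Fin d))) (y : ι → ℝ) (i : ι) :
    inner ℝ (b i) (coordEquiv b y) = y i := by
  rw [← b.repr_apply_apply]
  simp [coordEquiv]

lemma measurePreserving_coordEquiv (b : OrthonormalBasis ι ℝ (EuclideanSpace ℝ (Fin d))) :
    MeasurePreserving (coordEquiv b) :=
  b.measurePreserving_repr_symm.comp (PiLp.volume_preserving_toLp ι)

lemma map_coordEquiv_normalPi (b : OrthonormalBasis ι ℝ (EuclideanSpace ℝ (Fin d))) :
    (normalPi ι).map (coordEquiv b) = stdGaussian (EuclideanSpace ℝ (Fin d)) := by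
  rw [stdGaussian_eq_map_pi_orthonormalBasis b]
  congr 1
  ext1 y
  exact coordEquiv_apply b y

lemma withDensity_eq_map_coordEquiv (b : OrthonormalBasis ι ℝ (EuclideanSpace ℝ (Fin d)))
    {p : EuclideanSpace ℝ (Fin d) → ℝ} (hp : Measurable p) :
    volume.withDensity (fun x => ENNReal.ofReal (p x)) =
      ((normalPi ι).withDensity (gaussDensity fun y => p (coordEquiv b y))).map (coordEquiv b) := by
  have hq : Measurable fun y => p (coordEquiv b y) := hp.comp (coordEquiv b).measurable
  rw [withDensity_gaussDensity hq,
    map_withDensity_comp (coordEquiv b) volume hp.ennreal_ofReal,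
    (measurePreserving_coordEquiv b).map_eq]

end Transfer

/-! ### The ridge approximation as a coordinate average -/

section RidgeApprox

open Finset

variable {d r n : ℕ}

/-- The indices of the coordinates orthogonal to the features. -/
def orthIndices (r n : ℕ) : Finset (Fin r ⊕ Fin n) := univ.map Function.Embedding.inr

lemma feature_coordEquiv {U : Matrix (Fin d) (Fin r) ℝ}
    {b : OrthonormalBasis (Fin r ⊕ Fin n) ℝ (EuclideanSpace ℝ (Fin d))}
    (hb : ∀ i k, b (.inl i) k = U k i) (y : Fin r ⊕ Fin n → ℝ) :
    feature U (coordEquiv b y) = WithLp.toLp 2 (fun i => y (.inl i)) := by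
  ext i
  change _ = y (.inl i)
  rw [← inner_coordEquiv b y (.inl i)]
  simp [feature, Matrix.mulVec, dotProduct, hb, PiLp.inner_apply, mul_comm]

/-- Both sides, as functions of the features, are densities of the law of the features under π with
respect to their law under μ. -/
lemma klProfile_feature_ae_eq {U : Matrix (Fin d) (Fin r) ℝ}
    {b : OrthonormalBasis (Fin r ⊕ Fin n) ℝ (EuclideanSpace ℝ (Fin d))}
    (hb : ∀ i k, b (.inl i) k = U k i) {f : (Fin r ⊕ Fin n → ℝ) → ℝ≥0∞} (hf : Measurable f)
    (hf1 : ∫⁻ y, f y ∂(normalPi (Fin r ⊕ Fin n)) = 1) :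
    (fun y => klProfile (((normalPi (Fin r ⊕ Fin n)).withDensity f).map (coordEquiv b))
      (stdGaussian (EuclideanSpace ℝ (Fin d))) U (feature U (coordEquiv b y)))
      =ᵐ[normalPi (Fin r ⊕ Fin n)]
        ∫⋯∫⁻_(orthIndices r n), f ∂fun _ => gaussianReal 0 1 := by
  have : IsProbabilityMeasure ((normalPi (Fin r ⊕ Fin n)).withDensity f) := ⟨by simp [hf1]⟩
  set e := coordEquiv b
  set ν := normalPi (Fin r ⊕ Fin n)
  set μ := stdGaussian (EuclideanSpace ℝ (Fin d)) with hμ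
  set π := (ν.withDensity f).map e
  have hνμ : ν.map e = μ := map_coordEquiv_normalPi b
  have : IsProbabilityMeasure π := Measure.isProbabilityMeasure_map e.measurable.aemeasurable
  set fs := ∫⋯∫⁻_(orthIndices r n), f ∂fun _ => gaussianReal 0 1
  have hfs : Measurable fs := hf.lmarginal _
  have hU := measurable_feature U
  have hac : π ≪ μ := by
    rw [← hνμ]
    exact (withDensity_absolutelyContinuous ν f).map e.measurable
  -- The padding by 0 is immaterial: fs does not depend on the orthogonal coordinates.
  set h : EuclideanSpace ℝ (Fin r) → ℝ≥0∞ := fun θ => fs (Sum.elim θ.ofLp 0)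
  have hh : Measurable h := by
    refine hfs.comp (measurable_pi_iff.2 fun i => ?_)
    rcases i with i | i
    · simp only [Sum.elim_inl]; fun_prop
    · simp only [Sum.elim_inr]; fun_prop
  have hfeat : ∀ y, feature U (e y) = WithLp.toLp 2 (fun i => y (.inl i)) :=
    feature_coordEquiv hb
  have hhfs : ∀ y, h (feature U (e y)) = fs y := fun y => by
    rw [hfeat]
    refine lmarginal_congr _ f fun i hi => ?_
    rcases i with i | i
    · rfl
    · simp [orthIndices] at hi
  have hUe : Measurable fun y => feature U (e y) := hU.comp e.measurable
  have hmap : μ.map (feature U) = ν.map fun y => feature U (e y) := by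
    rw [← hνμ, Measure.map_map hU e.measurable]; rfl
  have hwd : (μ.map (feature U)).withDensity h = π.map (feature U) := by
    ext B hB
    rw [withDensity_apply _ hB, Measure.map_apply hU hB, hmap,
      setLIntegral_map hB hh hUe, Measure.map_apply e.measurable (hU hB),
      withDensity_apply _ (e.measurable (hU hB)),
      ← lintegral_indicator (hUe hB)]
    change _ = ∫⁻ y in (fun y => feature U (e y)) ⁻¹' B, f y ∂ν
    rw [← lintegral_indicator (hUe hB)]
    set A := (fun y => feature U (e y)) ⁻¹' B
    have hA : MeasurableSet A := hUe hB
    simp_rw [hhfs]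
    have e1 : A.indicator f = fun y => A.indicator 1 y * f y := by
      ext y; by_cases hy : y ∈ A <;> simp [hy]
    rw [← lintegral_lmarginal (hf.indicator hA) (orthIndices r n), e1]
    refine lintegral_congr fun y => ?_
    rw [lmarginal_mul_left hf]
    · by_cases hy : y ∈ A <;> simp [hy, fs]
    · intro x z hxz
      have hxz' : feature U (e x) = feature U (e z) := by
        rw [hfeat, hfeat]
        congr 1
        ext i
        exact hxz _ (by simp [orthIndices])
      have : x ∈ A ↔ z ∈ A := by
        change feature U (e x) ∈ B ↔ feature U (e z) ∈ B
        rw [hxz']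
      by_cases hz : z ∈ A
      · simp [hz, this.2 hz]
      · simp [hz, this.not.2 hz]
  have hae : klProfile π μ U =ᵐ[μ.map (feature U)] h := by
    have : IsProbabilityMeasure (μ.map (feature U)) :=
      Measure.isProbabilityMeasure_map hU.aemeasurable
    rw [← withDensity_eq_iff_of_sigmaFinite (measurable_klProfile π μ U).aemeasurable
      hh.aemeasurable, hwd, withDensity_klProfile π μ hac U]
  rw [hmap] at hae
  filter_upwards [ae_of_ae_map hUe.aemeasurable hae] with y hy
  rw [hy, hhfs]

theorem klDiv_ridgeApprox {U : Matrix (Fin d) (Fin r) ℝ}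
    {b : OrthonormalBasis (Fin r ⊕ Fin n) ℝ (EuclideanSpace ℝ (Fin d))}
    (hb : ∀ i k, b (.inl i) k = U k i) {f : (Fin r ⊕ Fin n → ℝ) → ℝ≥0∞} (hf : Measurable f)
    (hf1 : ∫⁻ y, f y ∂(normalPi (Fin r ⊕ Fin n)) = 1) :
    klDiv (((normalPi (Fin r ⊕ Fin n)).withDensity f).map (coordEquiv b))
      (ridgeApprox (((normalPi (Fin r ⊕ Fin n)).withDensity f).map (coordEquiv b))
        (stdGaussian (EuclideanSpace ℝ (Fin d))) U) =
    ∫⁻ y, klDensity (f y)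
      ((∫⋯∫⁻_(orthIndices r n), f ∂fun _ => gaussianReal 0 1) y) ∂(normalPi (Fin r ⊕ Fin n)) := by
  have : IsProbabilityMeasure ((normalPi (Fin r ⊕ Fin n)).withDensity f) := ⟨by simp [hf1]⟩
  have hae := klProfile_feature_ae_eq hb hf hf1
  set e := coordEquiv b
  set ν := normalPi (Fin r ⊕ Fin n)
  set μ := stdGaussian (EuclideanSpace ℝ (Fin d)) with hμ
  set π := (ν.withDensity f).map e
  have hνμ : ν.map e = μ := map_coordEquiv_normalPi b
  set fs := ∫⋯∫⁻_(orthIndices r n), f ∂fun _ => gaussianReal 0 1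
  have hfs : Measurable fs := hf.lmarginal _
  have hfs1 : ∫⁻ y, fs y ∂ν = 1 := by rw [lintegral_lmarginal hf, hf1]
  have : IsProbabilityMeasure (ν.withDensity fs) := ⟨by simp [hfs1]⟩
  have hm : Measurable fun x => klProfile π μ U (feature U x) :=
    (measurable_klProfile π μ U).comp (measurable_feature U)
  have hridge : ridgeApprox π μ U = (ν.withDensity fs).map e := by
    rw [ridgeApprox, normalized]
    have : ∫⁻ x, klProfile π μ U (feature U x) ∂μ = 1 := by
      calc ∫⁻ x, klProfile π μ U (feature U x) ∂μ
          = ∫⁻ x, klProfile π μ U (feature U x) ∂(ν.map e) := by simp only [hνμ]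
        _ = 1 := by rw [lintegral_map hm e.measurable, lintegral_congr_ae hae, hfs1]
    rw [this, inv_one, one_smul, ← withDensity_congr_ae hae]
    have h := map_withDensity_comp e ν hm
    simp only [hνμ] at h
    exact h.symm
  rw [hridge, klDiv_map_equiv, klDiv_withDensity hf hfs (by rw [hf1]; simp) (by rw [hfs1]; simp)
    (ae_lmarginal_ne_zero hf _)]

end RidgeApprox

/-! ### Adapted bases and complementary minors -/

section LinearAlgebra

open Finset

variable {d r : ℕ} {ι : Type*} [Fintype ι]

lemma card_eq_of_orthonormalBasis (b : OrthonormalBasis ι ℝ (EuclideanSpace ℝ (Fin d))) :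
    Fintype.card ι = d := by
  rw [← Module.finrank_eq_card_basis b.toBasis, finrank_euclideanSpace_fin]

variable [DecidableEq ι]

/-- The matrix whose columns are the vectors of an orthonormal basis. -/
noncomputable def basisMatrix (b : OrthonormalBasis ι ℝ (EuclideanSpace ℝ (Fin d))) :
    Matrix (Fin d) ι ℝ :=
  Matrix.of fun k i => b i k

lemma basisMatrix_transpose_mul_self (b : OrthonormalBasis ι ℝ (EuclideanSpace ℝ (Fin d))) :
    (basisMatrix b)ᵀ * basisMatrix b = 1 := by
  ext i j
  have h := orthonormal_iff_ite.1 b.orthonormal i j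
  rw [Matrix.one_apply, ← h]
  simp [basisMatrix, Matrix.mul_apply, PiLp.inner_apply, mul_comm]

lemma basisMatrix_mul_transpose_self (b : OrthonormalBasis ι ℝ (EuclideanSpace ℝ (Fin d))) :
    basisMatrix b * (basisMatrix b)ᵀ = 1 := by
  have e : ι ≃ Fin d := Fintype.equivOfCardEq (by simp [card_eq_of_orthonormalBasis b])
  exact (Matrix.mul_eq_one_comm_of_equiv e).1 (basisMatrix_transpose_mul_self b)

lemma transpose_mul_mul_apply_self {m : Type*} (M : Matrix (Fin d) (Fin d) ℝ)
    (Q : Matrix (Fin d) m ℝ) (j : m) :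
    (Qᵀ * M * Q) j j = (fun k => Q k j) ⬝ᵥ M *ᵥ (fun k => Q k j) := by
  rw [Matrix.mul_assoc, Matrix.mul_apply]
  rfl

lemma sum_dotProduct_mulVec_eq_trace (b : OrthonormalBasis ι ℝ (EuclideanSpace ℝ (Fin d)))
    (M : Matrix (Fin d) (Fin d) ℝ) :
    ∑ i, (b i).ofLp ⬝ᵥ M *ᵥ (b i).ofLp = M.trace := by
  have h : ∑ i, (b i).ofLp ⬝ᵥ M *ᵥ (b i).ofLp = ((basisMatrix b)ᵀ * M * basisMatrix b).trace :=
    Finset.sum_congr rfl fun i _ => (transpose_mul_mul_apply_self M (basisMatrix b) i).symm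
  rw [h, Matrix.trace_mul_comm, ← Matrix.mul_assoc, basisMatrix_mul_transpose_self, Matrix.one_mul]

lemma exists_orthonormalBasis_of_columns (hcard : Fintype.card ι = d) (s : Set ι)
    (Q : Matrix (Fin d) ι ℝ) (hQ : ∀ i ∈ s, ∀ j ∈ s, (Qᵀ * Q) i j = (1 : Matrix ι ι ℝ) i j) :
    ∃ b : OrthonormalBasis ι ℝ (EuclideanSpace ℝ (Fin d)), ∀ i ∈ s, ∀ k, b i k = Q k i := by
  set v : ι → EuclideanSpace ℝ (Fin d) := fun i => WithLp.toLp 2 fun k => Q k i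
  have hv : Orthonormal ℝ (s.domRestrict v) := by
    rw [orthonormal_iff_ite]
    rintro ⟨i, hi⟩ ⟨j, hj⟩
    have h := hQ i hi j hj
    rw [Matrix.one_apply, Matrix.mul_apply] at h
    simp only [Subtype.mk.injEq]
    rw [← h]
    simp [v, PiLp.inner_apply, mul_comm]
  obtain ⟨b, hb⟩ := hv.exists_orthonormalBasis_extension_of_card_eq
    (by rw [finrank_euclideanSpace_fin, hcard])
  exact ⟨b, fun i hi k => by rw [hb i hi]⟩

lemma le_of_transpose_mul_self_eq_one {U : Matrix (Fin d) (Fin r) ℝ} (hU : Uᵀ * U = 1) :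
    r ≤ d := by
  have h1 : (Uᵀ * U).rank = r := by rw [hU, Matrix.rank_one, Fintype.card_fin]
  have h2 := (Matrix.rank_mul_le_right Uᵀ U).trans U.rank_le_card_height
  rwa [h1, Fintype.card_fin] at h2

/-- Jacobi's complementary minor identity, in an orthonormal basis. -/
lemma det_mul_det_transpose_mul_inv_mul {n : ℕ} {A : Matrix (Fin d) (Fin d) ℝ}
    (hA : IsUnit A.det) {U : Matrix (Fin d) (Fin r) ℝ} {V : Matrix (Fin d) (Fin n) ℝ}
    (h1 : (Matrix.fromCols U V)ᵀ * Matrix.fromCols U V = 1)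
    (h2 : Matrix.fromCols U V * (Matrix.fromCols U V)ᵀ = 1) :
    A.det * (Uᵀ * A⁻¹ * U).det = (Vᵀ * A * V).det := by
  set Q := Matrix.fromCols U V with hQ
  have hS : ∀ M : Matrix (Fin d) (Fin d) ℝ, Qᵀ * M * Q =
      Matrix.fromBlocks (Uᵀ * M * U) (Uᵀ * M * V) (Vᵀ * M * U) (Vᵀ * M * V) := fun M => by
    rw [hQ, Matrix.transpose_fromCols, Matrix.fromRows_mul, Matrix.fromRows_mul_fromCols]
  have hinv : (Qᵀ * A * Q) * (Qᵀ * A⁻¹ * Q) = 1 := by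
    calc (Qᵀ * A * Q) * (Qᵀ * A⁻¹ * Q) = Qᵀ * (A * (Q * Qᵀ) * A⁻¹) * Q := by
          simp only [Matrix.mul_assoc]
      _ = 1 := by rw [h2, Matrix.mul_one, Matrix.mul_nonsing_inv _ hA, Matrix.mul_one, h1]
  rw [hS, hS, Matrix.fromBlocks_multiply, ← Matrix.fromBlocks_one, Matrix.fromBlocks_inj] at hinv
  obtain ⟨e11, -, e21, -⟩ := hinv
  -- In block form QᵀAQ is multiplied by the first block column of its inverse, completed by (0, 1).
  -- Both factors on the left and the product have explicit determinants.
  have hprod : (Qᵀ * A * Q) * Matrix.fromBlocks (Uᵀ * A⁻¹ * U) 0 (Vᵀ * A⁻¹ * U) 1 =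
      Matrix.fromBlocks 1 (Uᵀ * A * V) 0 (Vᵀ * A * V) := by
    rw [hS, Matrix.fromBlocks_multiply, e11, e21]
    simp
  have h := congrArg Matrix.det hprod
  rwa [Matrix.det_mul, Matrix.det_fromBlocks_zero₁₂, Matrix.det_fromBlocks_zero₂₁, Matrix.det_one,
    Matrix.det_one, mul_one, one_mul, Matrix.det_conj_of_mul_eq_one h1 h2] at h

/-- Take any orthonormal basis W of the complement of the features and rotate it by the eigenvectors
of WᵀAW. The compression of A becomes diagonal, so its determinant is the product of the diagonal
entries; for a general basis Hadamard's inequality would lose something. -/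
theorem exists_adapted_orthonormalBasis {U : Matrix (Fin d) (Fin r) ℝ} (hU : Uᵀ * U = 1)
    {A : Matrix (Fin d) (Fin d) ℝ} (hA : A.PosDef) :
    ∃ (n : ℕ) (b : OrthonormalBasis (Fin r ⊕ Fin n) ℝ (EuclideanSpace ℝ (Fin d))), r + n = d ∧
      (∀ i k, b (.inl i) k = U k i) ∧
      Real.log A.det + Real.log (Uᵀ * A⁻¹ * U).det =
        ∑ j, Real.log ((b (.inr j)).ofLp ⬝ᵥ A *ᵥ (b (.inr j)).ofLp) := by
  have hr := le_of_transpose_mul_self_eq_one hU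
  have hcard : Fintype.card (Fin r ⊕ Fin (d - r)) = d := by simp; omega
  obtain ⟨b₀, hb₀⟩ := exists_orthonormalBasis_of_columns hcard (Set.range Sum.inl)
    (Matrix.fromCols U 0) (by
      rintro _ ⟨i, rfl⟩ _ ⟨j, rfl⟩
      rw [Matrix.transpose_fromCols, Matrix.fromRows_mul_fromCols, hU, Matrix.fromBlocks_apply₁₁]
      simp [Matrix.one_apply])
  set W : Matrix (Fin d) (Fin (d - r)) ℝ := Matrix.of fun k j => b₀ (.inr j) k with hW
  have hbU : basisMatrix b₀ = Matrix.fromCols U W := by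
    ext k i
    rcases i with i | i
    · exact hb₀ _ ⟨i, rfl⟩ k
    · rfl
  have hb1 := basisMatrix_transpose_mul_self b₀
  rw [hbU, Matrix.transpose_fromCols, Matrix.fromRows_mul_fromCols, ← Matrix.fromBlocks_one,
    Matrix.fromBlocks_inj] at hb1
  obtain ⟨-, hUW, hWU, hWW⟩ := hb1
  have hB : (Wᵀ * A * W).IsHermitian := by
    have := Matrix.isHermitian_conjTranspose_mul_mul W hA.1
    rwa [Matrix.conjTranspose_eq_transpose_of_trivial] at this
  set O : Matrix (Fin (d - r)) (Fin (d - r)) ℝ :=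
    (hB.eigenvectorUnitary : Matrix (Fin (d - r)) (Fin (d - r)) ℝ) with hO
  have hOO : Oᵀ * O = 1 := by
    have := Unitary.coe_star_mul_self hB.eigenvectorUnitary
    rwa [Matrix.star_eq_conjTranspose, Matrix.conjTranspose_eq_transpose_of_trivial] at this
  have hdiag : Oᵀ * (Wᵀ * A * W) * O = Matrix.diagonal hB.eigenvalues := by
    have := hB.conjStarAlgAut_star_eigenvectorUnitary
    rwa [Unitary.conjStarAlgAut_star_apply, Matrix.star_eq_conjTranspose,
      Matrix.conjTranspose_eq_transpose_of_trivial] at this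
  set V := W * O with hV
  have h1 : (Matrix.fromCols U V)ᵀ * Matrix.fromCols U V = 1 := by
    rw [Matrix.transpose_fromCols, Matrix.fromRows_mul_fromCols, ← Matrix.fromBlocks_one, hU, hV,
      Matrix.transpose_mul, ← Matrix.mul_assoc, hUW, Matrix.mul_assoc, hWU, Matrix.mul_assoc,
      ← Matrix.mul_assoc Wᵀ, hWW, Matrix.one_mul, hOO, Matrix.zero_mul, Matrix.mul_zero]
  have e : Fin r ⊕ Fin (d - r) ≃ Fin d := Fintype.equivOfCardEq (by rw [hcard, Fintype.card_fin])
  have h2 := (Matrix.mul_eq_one_comm_of_equiv e).1 h1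
  obtain ⟨b, hb⟩ := exists_orthonormalBasis_of_columns hcard Set.univ
    (Matrix.fromCols U V) (fun i _ j _ => by rw [h1])
  refine ⟨d - r, b, by omega, fun i k => hb (.inl i) trivial k, ?_⟩
  have hVAV : Vᵀ * A * V = Matrix.diagonal hB.eigenvalues := by
    rw [← hdiag, hV, Matrix.transpose_mul]
    simp only [Matrix.mul_assoc]
  have hent : ∀ j, (b (.inr j)).ofLp ⬝ᵥ A *ᵥ (b (.inr j)).ofLp = hB.eigenvalues j := fun j => by
    have h3 : (b (.inr j)).ofLp = fun k => V k j := funext fun k => hb (.inr j) trivial k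
    rw [h3, ← transpose_mul_mul_apply_self, hVAV, Matrix.diagonal_apply_eq]
  have hpos : ∀ j, 0 < hB.eigenvalues j := fun j => by
    rw [← hent]
    have hne : (b (.inr j)).ofLp ≠ 0 := fun h0 => b.orthonormal.ne_zero (.inr j)
      (by ext k; simp [h0])
    simpa using hA.dotProduct_mulVec_pos hne
  have hdet := det_mul_det_transpose_mul_inv_mul hA.det_pos.ne'.isUnit h1 h2
  rw [hVAV, Matrix.det_diagonal] at hdet
  -- The logarithm of the product splits only if neither factor is zero.
  have hne : (Uᵀ * A⁻¹ * U).det ≠ 0 := fun h0 => by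
    rw [h0, mul_zero] at hdet
    exact (Finset.prod_pos fun j _ => hpos j).ne hdet
  rw [← Real.log_mul hA.det_pos.ne' hne, hdet, Real.log_prod fun j _ => (hpos j).ne']
  simp only [hent]

end LinearAlgebra

/-! ### Moment matrices and their positive definiteness -/

section Moments

open Finset

variable {d : ℕ}

lemma inner_eq_dotProduct (x y : EuclideanSpace ℝ (Fin d)) : inner ℝ x y = x.ofLp ⬝ᵥ y.ofLp := by
  simp [PiLp.inner_apply, dotProduct, mul_comm]

lemma abs_mul_apply_le (x : EuclideanSpace ℝ (Fin d)) (i j : Fin d) : |x i * x j| ≤ ‖x‖ ^ 2 := by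
  rw [abs_mul, sq]
  exact mul_le_mul (PiLp.norm_apply_le x i) (PiLp.norm_apply_le x j) (abs_nonneg _) (norm_nonneg _)

lemma integrable_mul_apply {α : Type*} [MeasurableSpace α] {π : Measure α}
    {g : α → EuclideanSpace ℝ (Fin d)} (hg : Measurable g) (hi : Integrable (fun x => ‖g x‖ ^ 2) π)
    (i j : Fin d) : Integrable (fun x => g x i * g x j) π :=
  hi.mono' (by fun_prop) (ae_of_all _ fun x => abs_mul_apply_le (g x) i j)

lemma sq_dotProduct (v x : Fin d → ℝ) :
    (v ⬝ᵥ x) ^ 2 = ∑ i, ∑ j, v i * (x i * x j * v j) := by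
  rw [sq, dotProduct, Finset.sum_mul_sum]
  exact Finset.sum_congr rfl fun i _ => Finset.sum_congr rfl fun j _ => by ring

lemma integrable_sq_dotProduct {α : Type*} [MeasurableSpace α] {π : Measure α}
    {g : α → EuclideanSpace ℝ (Fin d)} (hg : ∀ i j, Integrable (fun x => g x i * g x j) π)
    (v : Fin d → ℝ) : Integrable (fun x => (v ⬝ᵥ (g x).ofLp) ^ 2) π := by
  simp_rw [sq_dotProduct]
  exact integrable_finsetSum _ fun i _ => integrable_finsetSum _ fun j _ =>
    ((hg i j).mul_const _).const_mul _

lemma dotProduct_moment_mulVec {α : Type*} [MeasurableSpace α] {π : Measure α}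
    {g : α → EuclideanSpace ℝ (Fin d)} (hg : ∀ i j, Integrable (fun x => g x i * g x j) π)
    (v : Fin d → ℝ) :
    v ⬝ᵥ (Matrix.of fun i j => ∫ x, g x i * g x j ∂π) *ᵥ v = ∫ x, (v ⬝ᵥ (g x).ofLp) ^ 2 ∂π := by
  simp_rw [sq_dotProduct]
  rw [integral_finsetSum _ fun i _ => integrable_finsetSum _ fun j _ =>
    ((hg i j).mul_const _).const_mul _]
  simp only [dotProduct, Matrix.mulVec, Matrix.of_apply, Finset.mul_sum]
  refine Finset.sum_congr rfl fun i _ => ?_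
  rw [integral_finsetSum _ fun j _ => ((hg i j).mul_const _).const_mul _]
  exact Finset.sum_congr rfl fun j _ => by rw [integral_const_mul, integral_mul_const]

lemma posDef_moment {α : Type*} [MeasurableSpace α] {π : Measure α}
    {g : α → EuclideanSpace ℝ (Fin d)} (hg : ∀ i j, Integrable (fun x => g x i * g x j) π)
    (hpos : ∀ v : Fin d → ℝ, (∀ᵐ x ∂π, v ⬝ᵥ (g x).ofLp = 0) → v = 0) :
    (Matrix.of fun i j => ∫ x, g x i * g x j ∂π).PosDef := by
  refine Matrix.PosDef.of_dotProduct_mulVec_pos ?_ fun v hv => ?_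
  · ext i j
    simp [Matrix.conjTranspose_apply, mul_comm]
  · rw [star_trivial, dotProduct_moment_mulVec hg]
    refine lt_of_le_of_ne (integral_nonneg fun x => sq_nonneg _) fun h => hv (hpos v ?_)
    rw [eq_comm, integral_eq_zero_iff_of_nonneg (fun x => sq_nonneg _)
      (integrable_sq_dotProduct hg v)] at h
    filter_upwards [h] with x hx
    simpa using hx

lemma integrable_apply {π : Measure (EuclideanSpace ℝ (Fin d))} [IsFiniteMeasure π]
    (hM : Integrable (fun x : EuclideanSpace ℝ (Fin d) => ‖x‖ ^ 2) π) (i : Fin d) :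
    Integrable (fun x : EuclideanSpace ℝ (Fin d) => x i) π := by
  refine ((integrable_const 1).add hM).mono' (by fun_prop) (ae_of_all _ fun x => ?_)
  have h1 := PiLp.norm_apply_le x i
  simp only [Pi.add_apply]
  nlinarith [sq_nonneg (‖x‖ - 1), norm_nonneg x]

/-- The mean of a measure on a Euclidean space, as a vector of coordinates. -/
noncomputable def meanVec (π : Measure (EuclideanSpace ℝ (Fin d))) : EuclideanSpace ℝ (Fin d) :=
  WithLp.toLp 2 fun i => ∫ x, x i ∂π

lemma integrable_centered_mul {π : Measure (EuclideanSpace ℝ (Fin d))} [IsProbabilityMeasure π]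
    (hM : Integrable (fun x : EuclideanSpace ℝ (Fin d) => ‖x‖ ^ 2) π) (i j : Fin d) :
    Integrable (fun x => (x - meanVec π) i * (x - meanVec π) j) π := by
  have h : ∀ x : EuclideanSpace ℝ (Fin d), (x - meanVec π) i * (x - meanVec π) j =
      x i * x j - x i * meanVec π j - meanVec π i * x j + meanVec π i * meanVec π j := fun x => by
    simp only [PiLp.sub_apply]; ring
  simp_rw [h]
  exact (((integrable_mul_apply measurable_id hM i j).sub ((integrable_apply hM i).mul_const _)).sub
    ((integrable_apply hM j).const_mul _)).add (integrable_const _)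

lemma covMatrix_eq {π : Measure (EuclideanSpace ℝ (Fin d))} [IsProbabilityMeasure π]
    (hM : Integrable (fun x : EuclideanSpace ℝ (Fin d) => ‖x‖ ^ 2) π) :
    covMatrix π = Matrix.of fun i j => ∫ x, (x - meanVec π) i * (x - meanVec π) j ∂π := by
  ext i j
  have h : ∀ x : EuclideanSpace ℝ (Fin d), (x - meanVec π) i * (x - meanVec π) j =
      x i * x j - x i * meanVec π j - meanVec π i * x j + meanVec π i * meanVec π j := fun x => by
    simp only [PiLp.sub_apply]; ring
  have i1 : Integrable (fun x : EuclideanSpace ℝ (Fin d) => x i * x j) π :=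
    integrable_mul_apply measurable_id hM i j
  have i2 : Integrable (fun x : EuclideanSpace ℝ (Fin d) => x i * meanVec π j) π :=
    (integrable_apply hM i).mul_const _
  have i3 : Integrable (fun x : EuclideanSpace ℝ (Fin d) => meanVec π i * x j) π :=
    (integrable_apply hM j).const_mul _
  have i12 : Integrable (fun x : EuclideanSpace ℝ (Fin d) => x i * x j - x i * meanVec π j) π :=
    i1.sub i2
  have i123 : Integrable (fun x : EuclideanSpace ℝ (Fin d) =>
    x i * x j - x i * meanVec π j - meanVec π i * x j) π := i12.sub i3
  simp_rw [Matrix.of_apply, h]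
  rw [integral_add i123 (integrable_const _), integral_sub i12 i3, integral_sub i1 i2,
    integral_mul_const, integral_const_mul]
  simp only [covMatrix, secondMoment, meanVec, Matrix.sub_apply, Matrix.of_apply,
    Matrix.vecMulVec_apply, integral_const, probReal_univ, one_smul]
  ring

/-- For v ≠ 0 the measure would be carried by a hyperplane, which is Lebesgue-null. -/
lemma dotProduct_eq_zero_imp {v : Fin d → ℝ} {π : Measure (EuclideanSpace ℝ (Fin d))}
    [IsProbabilityMeasure π] (hac : π ≪ volume) {c : ℝ}
    (h : ∀ᵐ x ∂π, v ⬝ᵥ x.ofLp = c) : v = 0 := by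
  by_contra hv
  set w : EuclideanSpace ℝ (Fin d) := WithLp.toLp 2 v
  have hw : w ≠ 0 := fun h0 => hv (by rw [← WithLp.ofLp_toLp 2 v]; exact congrArg WithLp.ofLp h0)
  obtain ⟨x₀, hx₀⟩ := h.exists
  set S := AffineSubspace.mk' x₀ (innerSL ℝ w).toLinearMap.ker
  have hS : S ≠ ⊤ := fun htop => by
    have h1 : x₀ + w ∈ S := htop ▸ AffineSubspace.mem_top ℝ _ _
    rw [AffineSubspace.mem_mk', vsub_eq_sub, add_sub_cancel_left] at h1
    have h2 : inner ℝ w w = 0 := h1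
    exact hw (inner_self_eq_zero.1 h2)
  have h0 : π S = 0 := hac (Measure.addHaar_affineSubspace volume S hS)
  have h1 : ∀ᵐ x ∂π, x ∈ (S : Set (EuclideanSpace ℝ (Fin d))) := by
    filter_upwards [h] with x hx
    rw [SetLike.mem_coe, AffineSubspace.mem_mk', vsub_eq_sub]
    change inner ℝ w (x - x₀) = 0
    rw [inner_sub_right, inner_eq_dotProduct, inner_eq_dotProduct]
    exact sub_eq_zero.2 (hx.trans hx₀.symm)
  obtain ⟨x, hx, hx'⟩ := (h1.and (measure_eq_zero_iff_ae_notMem.1 h0)).exists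
  exact hx' hx

lemma posDef_covMatrix {π : Measure (EuclideanSpace ℝ (Fin d))} [IsProbabilityMeasure π]
    (hac : π ≪ volume) (hM : Integrable (fun x : EuclideanSpace ℝ (Fin d) => ‖x‖ ^ 2) π) :
    (covMatrix π).PosDef := by
  rw [covMatrix_eq hM]
  refine posDef_moment (integrable_centered_mul hM) fun v hv => ?_
  refine dotProduct_eq_zero_imp hac (c := v ⬝ᵥ (meanVec π).ofLp) ?_
  filter_upwards [hv] with x hx
  rwa [WithLp.ofLp_sub, dotProduct_sub, sub_eq_zero] at hx

lemma measurable_score (p : EuclideanSpace ℝ (Fin d) → ℝ) : Measurable (score p) :=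
  (InnerProductSpace.toDual ℝ (EuclideanSpace ℝ (Fin d))).symm.continuous.measurable.comp
    (measurable_fderiv ℝ _)

lemma dotProduct_score {p : EuclideanSpace ℝ (Fin d) → ℝ} {x : EuclideanSpace ℝ (Fin d)}
    (hp : DifferentiableAt ℝ p x) (hx : p x ≠ 0) (w : EuclideanSpace ℝ (Fin d)) :
    w.ofLp ⬝ᵥ (score p x).ofLp = fderiv ℝ p x w / p x := by
  rw [← inner_eq_dotProduct, real_inner_comm, score]
  have h : inner ℝ (gradient (fun y => Real.log (p y)) x) w =
      fderiv ℝ (fun y => Real.log (p y)) x w := by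
    rw [← toDual_gradient, InnerProductSpace.toDual_apply_apply]
  rw [h, (hp.hasFDerivAt.log hx).fderiv]
  simp [div_eq_inv_mul]

lemma fderiv_eq_zero_of_nonneg {E : Type*} [NormedAddCommGroup E] [NormedSpace ℝ E] {p : E → ℝ}
    (h0 : ∀ x, 0 ≤ p x) {x : E} (hx : p x = 0) : fderiv ℝ p x = 0 :=
  IsLocalMin.fderiv_eq_zero (Filter.Eventually.of_forall fun y => hx ▸ h0 y)

/-- If the score is orthogonal to v almost surely, p is constant along v, so π is invariant under
translation by v. Its mean, finite by the moment hypothesis, cannot move, hence v = 0. -/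
lemma eq_zero_of_ae_dotProduct_score_eq_zero {π : Measure (EuclideanSpace ℝ (Fin d))}
    [IsProbabilityMeasure π] {p : EuclideanSpace ℝ (Fin d) → ℝ} (hp : ContDiff ℝ 1 p)
    (hp0 : ∀ x, 0 ≤ p x) (hπ : π = volume.withDensity (fun x => ENNReal.ofReal (p x)))
    (hM : Integrable (fun x : EuclideanSpace ℝ (Fin d) => ‖x‖ ^ 2) π) {v : Fin d → ℝ}
    (hv : ∀ᵐ x ∂π, v ⬝ᵥ (score p x).ofLp = 0) : v = 0 := by
  set w : EuclideanSpace ℝ (Fin d) := WithLp.toLp 2 v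
  have hdiff := hp.differentiable one_ne_zero
  have hpm : Measurable fun x => ENNReal.ofReal (p x) := hp.continuous.measurable.ennreal_ofReal
  have hD : ∀ x, fderiv ℝ p x w = 0 := by
    have hc : Continuous fun x => fderiv ℝ p x w :=
      (hp.continuous_fderiv one_ne_zero).clm_apply continuous_const
    have hae : (fun x => fderiv ℝ p x w) =ᵐ[volume] fun _ => 0 := by
      rw [hπ, ae_withDensity_iff hpm] at hv
      filter_upwards [hv] with x hx
      by_cases h : p x = 0
      · rw [fderiv_eq_zero_of_nonneg hp0 h]; rfl
      · have h1 := hx (by simpa using (hp0 x).lt_of_ne' h)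
        rw [show v = w.ofLp from rfl, dotProduct_score (hdiff x) h, div_eq_zero_iff] at h1
        exact h1.resolve_right h
    -- Continuity of the derivative upgrades the almost everywhere identity to every point.
    exact congrFun ((Continuous.ae_eq_iff_eq volume hc continuous_const).1 hae)
  have htrans : ∀ x, p (x + w) = p x := fun x => by
    have hd : ∀ t : ℝ, HasDerivAt (fun t : ℝ => p (x + t • w)) 0 t := fun t => by
      have h1 : HasDerivAt (fun t : ℝ => x + t • w) w t := by
        simpa using ((hasDerivAt_id t).smul_const w).const_add x
      have h2 := (hdiff (x + t • w)).hasFDerivAt.comp_hasDerivAt t h1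
      rwa [hD] at h2
    have := is_const_of_deriv_eq_zero (fun t => (hd t).differentiableAt)
      (fun t => (hd t).deriv) 1 0
    simpa using this
  have hmap : π.map (fun x => x + w) = π := by
    have h := map_withDensity_comp (MeasurableEquiv.addRight w) volume hpm
    have e1 : (fun x => ENNReal.ofReal (p (MeasurableEquiv.addRight w x))) =
        fun x => ENNReal.ofReal (p x) := funext fun x => by
      rw [MeasurableEquiv.coe_addRight, htrans]
    have hv : (volume : Measure (EuclideanSpace ℝ (Fin d))).map (fun x => x + w) = volume :=
      map_add_right_eq_self volume w
    rwa [e1, MeasurableEquiv.coe_addRight, hv, ← hπ] at h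
  have hint : Integrable (fun x => inner ℝ w x) π := by
    simp_rw [inner_eq_dotProduct, dotProduct]
    exact integrable_finsetSum _ fun i _ => (integrable_apply hM i).const_mul _
  have h1 : ∫ x, inner ℝ w x ∂π = ∫ x, inner ℝ w x ∂π + inner ℝ w w := by
    have hc : Continuous fun x : EuclideanSpace ℝ (Fin d) => inner ℝ w x := by fun_prop
    conv_lhs => rw [← hmap]
    rw [integral_map (by fun_prop) hc.aestronglyMeasurable]
    simp_rw [inner_add_right]
    rw [integral_add hint (integrable_const _)]
    simp
  have h2 : inner ℝ w w = 0 := by linarith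
  exact congrArg WithLp.ofLp (inner_self_eq_zero.1 h2)

lemma posDef_fisherMatrix {π : Measure (EuclideanSpace ℝ (Fin d))}
    [IsProbabilityMeasure π] {p : EuclideanSpace ℝ (Fin d) → ℝ} (hp : ContDiff ℝ 1 p)
    (hp0 : ∀ x, 0 ≤ p x) (hπ : π = volume.withDensity (fun x => ENNReal.ofReal (p x)))
    (hM : Integrable (fun x : EuclideanSpace ℝ (Fin d) => ‖x‖ ^ 2) π)
    (hS : Integrable (fun x => ‖score p x‖ ^ 2) π) : (fisherMatrix π p).PosDef :=
  posDef_moment (integrable_mul_apply (measurable_score p) hS) fun _ hv =>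
    eq_zero_of_ae_dotProduct_score_eq_zero hp hp0 hπ hM hv

end Moments

/-! ### Scores and moments in orthonormal coordinates -/

section Coordinates

variable {ι : Type*} [Fintype ι] {d : ℕ}

lemma hasFDerivAt_coordEquiv (b : OrthonormalBasis ι ℝ (EuclideanSpace ℝ (Fin d))) (y : ι → ℝ) :
    HasFDerivAt (coordEquiv b)
      (∑ i, (ContinuousLinearMap.proj (R := ℝ) (φ := fun _ : ι => ℝ) i).smulRight (b i)) y := by
  have h : (coordEquiv b : (ι → ℝ) → EuclideanSpace ℝ (Fin d)) =
      ⇑(∑ i, (ContinuousLinearMap.proj (R := ℝ) (φ := fun _ : ι => ℝ) i).smulRight (b i)) := by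
    ext1 z
    simp [coordEquiv_apply]
  rw [h]
  exact ContinuousLinearMap.hasFDerivAt _

lemma contDiff_comp_coordEquiv (b : OrthonormalBasis ι ℝ (EuclideanSpace ℝ (Fin d)))
    {p : EuclideanSpace ℝ (Fin d) → ℝ} (hp : ContDiff ℝ 1 p) :
    ContDiff ℝ 1 fun y => p (coordEquiv b y) := by
  simp_rw [coordEquiv_apply]
  exact hp.comp (by fun_prop)

lemma partialScore_comp_coordEquiv [DecidableEq ι]
    (b : OrthonormalBasis ι ℝ (EuclideanSpace ℝ (Fin d)))
    {p : EuclideanSpace ℝ (Fin d) → ℝ} {y : ι → ℝ}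
    (hp : DifferentiableAt ℝ p (coordEquiv b y)) (hy : p (coordEquiv b y) ≠ 0) (j : ι) :
    partialScore (fun z => p (coordEquiv b z)) j y =
      (b j).ofLp ⬝ᵥ (score p (coordEquiv b y)).ofLp := by
  rw [dotProduct_score hp hy, partialScore]
  have h := (hp.hasFDerivAt.comp y (hasFDerivAt_coordEquiv b y)).fderiv
  rw [show (fun z => p (coordEquiv b z)) = p ∘ coordEquiv b from rfl, h,
    ContinuousLinearMap.comp_apply]
  congr 2
  simp [Pi.single_apply, ite_smul]

lemma lintegral_gaussDensity_eq_one (b : OrthonormalBasis ι ℝ (EuclideanSpace ℝ (Fin d)))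
    {p : EuclideanSpace ℝ (Fin d) → ℝ} (hp : Measurable p)
    [hP : IsProbabilityMeasure (volume.withDensity fun x => ENNReal.ofReal (p x))] :
    ∫⁻ y, gaussDensity (fun z => p (coordEquiv b z)) y ∂(normalPi ι) = 1 := by
  have h := hP.measure_univ
  rw [withDensity_eq_map_coordEquiv b hp, Measure.map_apply (coordEquiv b).measurable .univ] at h
  simpa using h

lemma basis_dotProduct_coordEquiv (b : OrthonormalBasis ι ℝ (EuclideanSpace ℝ (Fin d)))
    (y : ι → ℝ) (j : ι) : (b j).ofLp ⬝ᵥ (coordEquiv b y).ofLp = y j := by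
  rw [← inner_eq_dotProduct, inner_coordEquiv]

lemma basis_dotProduct_mulVec_pos (b : OrthonormalBasis ι ℝ (EuclideanSpace ℝ (Fin d)))
    {A : Matrix (Fin d) (Fin d) ℝ} (hA : A.PosDef) (j : ι) :
    0 < (b j).ofLp ⬝ᵥ A *ᵥ (b j).ofLp := by
  have hne : (b j).ofLp ≠ 0 := fun h0 => b.orthonormal.ne_zero j (by ext k; simp [h0])
  simpa using hA.dotProduct_mulVec_pos hne

variable {P : Measure (ι → ℝ)}

lemma integrable_sq_apply (b : OrthonormalBasis ι ℝ (EuclideanSpace ℝ (Fin d)))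
    (hM : Integrable (fun x : EuclideanSpace ℝ (Fin d) => ‖x‖ ^ 2) (P.map (coordEquiv b)))
    (j : ι) : Integrable (fun y => y j ^ 2) P := by
  have h := integrable_sq_dotProduct (integrable_mul_apply measurable_id hM) (b j).ofLp
  rw [integrable_map_equiv] at h
  refine h.congr (ae_of_all _ fun y => ?_)
  simp [basis_dotProduct_coordEquiv]

lemma integral_sq_apply (b : OrthonormalBasis ι ℝ (EuclideanSpace ℝ (Fin d)))
    (hM : Integrable (fun x : EuclideanSpace ℝ (Fin d) => ‖x‖ ^ 2) (P.map (coordEquiv b)))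
    (j : ι) : ∫ y, y j ^ 2 ∂P =
      (b j).ofLp ⬝ᵥ secondMoment (P.map (coordEquiv b)) *ᵥ (b j).ofLp := by
  refine Eq.trans ?_
    (dotProduct_moment_mulVec (integrable_mul_apply measurable_id hM) (b j).ofLp).symm
  rw [integral_map_equiv]
  simp [basis_dotProduct_coordEquiv]

lemma integrable_sq_apply_sub (b : OrthonormalBasis ι ℝ (EuclideanSpace ℝ (Fin d)))
    [IsProbabilityMeasure (P.map (coordEquiv b))]
    (hM : Integrable (fun x : EuclideanSpace ℝ (Fin d) => ‖x‖ ^ 2) (P.map (coordEquiv b)))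
    (j : ι) : Integrable
      (fun y => (y j - (b j).ofLp ⬝ᵥ (meanVec (P.map (coordEquiv b))).ofLp) ^ 2) P := by
  have h := integrable_sq_dotProduct (integrable_centered_mul hM) (b j).ofLp
  rw [integrable_map_equiv] at h
  refine h.congr (ae_of_all _ fun y => ?_)
  simp [basis_dotProduct_coordEquiv, dotProduct_sub]

lemma integral_sq_apply_sub (b : OrthonormalBasis ι ℝ (EuclideanSpace ℝ (Fin d)))
    [IsProbabilityMeasure (P.map (coordEquiv b))]
    (hM : Integrable (fun x : EuclideanSpace ℝ (Fin d) => ‖x‖ ^ 2) (P.map (coordEquiv b)))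
    (j : ι) : ∫ y, (y j - (b j).ofLp ⬝ᵥ (meanVec (P.map (coordEquiv b))).ofLp) ^ 2 ∂P =
      (b j).ofLp ⬝ᵥ covMatrix (P.map (coordEquiv b)) *ᵥ (b j).ofLp := by
  rw [covMatrix_eq hM, dotProduct_moment_mulVec (integrable_centered_mul hM), integral_map_equiv]
  simp [basis_dotProduct_coordEquiv, dotProduct_sub]

lemma lintegral_mul_gaussDensity (b : OrthonormalBasis ι ℝ (EuclideanSpace ℝ (Fin d)))
    {p : EuclideanSpace ℝ (Fin d) → ℝ} (hp : Measurable p) {g : EuclideanSpace ℝ (Fin d) → ℝ}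
    (hg : Measurable g) (hg0 : ∀ x, 0 ≤ g x)
    (hi : Integrable g (volume.withDensity fun x => ENNReal.ofReal (p x))) :
    ∫⁻ y, ENNReal.ofReal (g (coordEquiv b y)) * gaussDensity (fun z => p (coordEquiv b z)) y
      ∂(normalPi ι) =
    ENNReal.ofReal (∫ x, g x ∂(volume.withDensity fun x => ENNReal.ofReal (p x))) := by
  have hq : Measurable fun y => p (coordEquiv b y) := hp.comp (coordEquiv b).measurable
  have hgm : Measurable fun y => ENNReal.ofReal (g (coordEquiv b y)) :=
    (hg.comp (coordEquiv b).measurable).ennreal_ofReal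
  rw [ofReal_integral_eq_lintegral_ofReal hi (ae_of_all _ hg0), withDensity_eq_map_coordEquiv b hp,
    lintegral_map_equiv, lintegral_withDensity_eq_lintegral_mul _ (measurable_gaussDensity hq)
      hgm]
  simp only [Pi.mul_apply, mul_comm]

end Coordinates

/-! ### Assembling the two bounds -/

section Bounds

variable {d r n : ℕ}

lemma sum_orthIndices (g : Fin r ⊕ Fin n → ℝ) : ∑ j ∈ orthIndices r n, g j = ∑ j, g (.inr j) :=
  Finset.sum_map _ _ _

lemma sum_inr_dotProduct_mulVec {U : Matrix (Fin d) (Fin r) ℝ}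
    {b : OrthonormalBasis (Fin r ⊕ Fin n) ℝ (EuclideanSpace ℝ (Fin d))}
    (hb : ∀ i k, b (.inl i) k = U k i) (M : Matrix (Fin d) (Fin d) ℝ) :
    ∑ j, (b (.inr j)).ofLp ⬝ᵥ M *ᵥ (b (.inr j)).ofLp = M.trace - (Uᵀ * M * U).trace := by
  rw [← sum_dotProduct_mulVec_eq_trace b M, Fintype.sum_sum_type, Matrix.trace, eq_sub_iff_add_eq',
    add_left_inj]
  refine Finset.sum_congr rfl fun i _ => ?_
  rw [Matrix.diag_apply, transpose_mul_mul_apply_self,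
    show (fun k => U k i) = (b (.inl i)).ofLp from funext fun k => (hb i k).symm]

lemma minorant_eq_sum {U : Matrix (Fin d) (Fin r) ℝ}
    {b : OrthonormalBasis (Fin r ⊕ Fin n) ℝ (EuclideanSpace ℝ (Fin d))} (hn : r + n = d)
    (hb : ∀ i k, b (.inl i) k = U k i) {C : Matrix (Fin d) (Fin d) ℝ}
    (hC : Real.log C.det + Real.log (Uᵀ * C⁻¹ * U).det =
      ∑ j, Real.log ((b (.inr j)).ofLp ⬝ᵥ C *ᵥ (b (.inr j)).ofLp))
    (M : Matrix (Fin d) (Fin d) ℝ) :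
    minorant C M U = ∑ j ∈ orthIndices r n, ((b j).ofLp ⬝ᵥ M *ᵥ (b j).ofLp - 1 -
      Real.log ((b j).ofLp ⬝ᵥ C *ᵥ (b j).ofLp)) / 2 := by
  have hd : (d : ℝ) = r + n := by exact_mod_cast hn.symm
  rw [sum_orthIndices, ← Finset.sum_div, Finset.sum_sub_distrib, Finset.sum_sub_distrib, ← hC,
    sum_inr_dotProduct_mulVec hb]
  simp only [minorant, hd, Finset.sum_const, Finset.card_univ, Fintype.card_fin, nsmul_eq_mul]
  ring

lemma majorant_eq_sum {U : Matrix (Fin d) (Fin r) ℝ}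
    {b : OrthonormalBasis (Fin r ⊕ Fin n) ℝ (EuclideanSpace ℝ (Fin d))} (hn : r + n = d)
    (hb : ∀ i k, b (.inl i) k = U k i) {H : Matrix (Fin d) (Fin d) ℝ}
    (hH : Real.log H.det + Real.log (Uᵀ * H⁻¹ * U).det =
      ∑ j, Real.log ((b (.inr j)).ofLp ⬝ᵥ H *ᵥ (b (.inr j)).ofLp))
    (M : Matrix (Fin d) (Fin d) ℝ) :
    majorant H M U = ∑ j ∈ orthIndices r n, ((b j).ofLp ⬝ᵥ M *ᵥ (b j).ofLp - 1 +
      Real.log ((b j).ofLp ⬝ᵥ H *ᵥ (b j).ofLp)) / 2 := by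
  have hd : (d : ℝ) = r + n := by exact_mod_cast hn.symm
  rw [sum_orthIndices, ← Finset.sum_div, Finset.sum_add_distrib, Finset.sum_sub_distrib, ← hH,
    sum_inr_dotProduct_mulVec hb]
  simp only [majorant, hd, Finset.sum_const, Finset.card_univ, Fintype.card_fin, nsmul_eq_mul]
  ring

variable {π : Measure (EuclideanSpace ℝ (Fin d))} [IsProbabilityMeasure π]
  {p : EuclideanSpace ℝ (Fin d) → ℝ} {U : Matrix (Fin d) (Fin r) ℝ}

theorem ofReal_minorant_le_klDiv (hp : Measurable p)
    (hπ : π = volume.withDensity (fun x => ENNReal.ofReal (p x)))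
    (hM : Integrable (fun x : EuclideanSpace ℝ (Fin d) => ‖x‖ ^ 2) π) (hU : Uᵀ * U = 1) :
    ENNReal.ofReal (minorant (covMatrix π) (secondMoment π) U) ≤
      klDiv π (ridgeApprox π (stdGaussian (EuclideanSpace ℝ (Fin d))) U) := by
  have hC := posDef_covMatrix (hπ ▸ withDensity_absolutelyContinuous _ _) hM
  obtain ⟨n, b, hn, hb, hlog⟩ := exists_adapted_orthonormalBasis hU hC
  have hf1 : ∫⁻ y, gaussDensity (fun z => p (coordEquiv b z)) y ∂(normalPi (Fin r ⊕ Fin n)) = 1 :=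
    have : IsProbabilityMeasure (volume.withDensity fun x => ENNReal.ofReal (p x)) := hπ ▸ ‹_›
    lintegral_gaussDensity_eq_one b hp
  have hf := measurable_gaussDensity (hp.comp (coordEquiv b).measurable)
  rw [minorant_eq_sum hn hb hlog]
  obtain ⟨P, hP⟩ : ∃ P, P = (normalPi (Fin r ⊕ Fin n)).withDensity
    (gaussDensity fun y => p (coordEquiv b y)) := ⟨_, rfl⟩
  have hπP : π = P.map (coordEquiv b) := by rw [hπ, hP]; exact withDensity_eq_map_coordEquiv b hp
  have hkl := klDiv_ridgeApprox hb hf hf1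
  subst hπP
  rw [hP] at hM hC ⊢
  refine le_of_le_of_eq ?_ hkl.symm
  have : IsProbabilityMeasure (((normalPi (Fin r ⊕ Fin n)).withDensity
    (gaussDensity fun y => p (coordEquiv b y))).map (coordEquiv b)) := hP ▸ ‹_›
  exact ofReal_le_lintegral_klDensity hf hf1 _ (fun j _ => basis_dotProduct_mulVec_pos b hC j)
    (fun j _ => integrable_sq_apply b hM j) (fun j _ => integrable_sq_apply_sub b hM j)
    (fun j _ => integral_sq_apply b hM j) (fun j _ => integral_sq_apply_sub b hM j)

/-- Nonnegativity is part of the conclusion because `ENNReal.ofReal` truncates at zero; without it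
the real-valued upper bound could not be recovered. -/
theorem klDiv_le_majorant (hp : ContDiff ℝ 1 p) (hp0 : ∀ x, 0 ≤ p x)
    (hπ : π = volume.withDensity (fun x => ENNReal.ofReal (p x)))
    (hM : Integrable (fun x : EuclideanSpace ℝ (Fin d) => ‖x‖ ^ 2) π)
    (hS : Integrable (fun x => ‖score p x‖ ^ 2) π) (hU : Uᵀ * U = 1) :
    0 ≤ majorant (fisherMatrix π p) (secondMoment π) U ∧
    klDiv π (ridgeApprox π (stdGaussian (EuclideanSpace ℝ (Fin d))) U) ≤
      ENNReal.ofReal (majorant (fisherMatrix π p) (secondMoment π) U) := by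
  have hH := posDef_fisherMatrix hp hp0 hπ hM hS
  have hpm := hp.continuous.measurable
  obtain ⟨n, b, hn, hb, hlog⟩ := exists_adapted_orthonormalBasis hU hH
  have hf1 : ∫⁻ y, gaussDensity (fun z => p (coordEquiv b z)) y ∂(normalPi (Fin r ⊕ Fin n)) = 1 :=
    have : IsProbabilityMeasure (volume.withDensity fun x => ENNReal.ofReal (p x)) := hπ ▸ ‹_›
    lintegral_gaussDensity_eq_one b hpm
  have hf := measurable_gaussDensity (hpm.comp (coordEquiv b).measurable)
  have hkl := klDiv_ridgeApprox hb hf hf1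
  rw [show (p ∘ coordEquiv b) = fun y => p (coordEquiv b y) from rfl,
    ← withDensity_eq_map_coordEquiv b hpm, ← hπ] at hkl
  rw [majorant_eq_sum hn hb hlog, hkl]
  have him := integrable_mul_apply measurable_id hM
  have his := integrable_mul_apply (measurable_score p) hS
  have hms := measurable_score p
  refine lintegral_klDensity_lmarginal_le (contDiff_comp_coordEquiv b hp) (fun y => hp0 _) hf1 _
    (fun j _ => ?_) (fun j _ => basis_dotProduct_mulVec_pos b hH j) (fun j _ => ?_)
    (fun j _ => ?_)
  · exact le_of_le_of_eq (integral_nonneg fun _ => sq_nonneg _)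
      (dotProduct_moment_mulVec him (b j).ofLp).symm
  · have h := integrable_sq_dotProduct him (b j).ofLp
    rw [hπ] at h
    have h1 := lintegral_mul_gaussDensity b hpm (by simp only [dotProduct, id]; fun_prop)
      (fun _ => sq_nonneg _) h
    rw [← hπ, ← dotProduct_moment_mulVec him] at h1
    refine Eq.trans (lintegral_congr fun y => ?_) h1
    simp [basis_dotProduct_coordEquiv]
  · have h := integrable_sq_dotProduct his (b j).ofLp
    rw [hπ] at h
    have h1 := lintegral_mul_gaussDensity b hpm (by simp only [dotProduct]; fun_prop)
      (fun _ => sq_nonneg _) h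
    rw [← hπ, ← dotProduct_moment_mulVec his] at h1
    refine Eq.trans (lintegral_congr fun y => ?_) h1
    -- Where p vanishes the weight is zero, so the default values of the two scores need not agree.
    by_cases hy : p (coordEquiv b y) = 0
    · simp [gaussDensity, hy]
    · rw [partialScore_comp_coordEquiv b (hp.differentiable one_ne_zero _) hy]

end Bounds

end RidgeKL

theorem theorem2p2 {d r : ℕ}
    (π : Measure (EuclideanSpace ℝ (Fin d))) [IsProbabilityMeasure π]
    (p : EuclideanSpace ℝ (Fin d) → ℝ) (hp : ContDiff ℝ ∞ p) (hp0 : ∀ x, 0 ≤ p x)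
    (hπ : π = volume.withDensity (fun x => ENNReal.ofReal (p x)))
    (hM : Integrable (fun x : EuclideanSpace ℝ (Fin d) => ‖x‖ ^ 2) π)
    (U : Matrix (Fin d) (Fin r) ℝ) (hU : Uᵀ * U = 1) :
    ((RidgeKL.covMatrix π).PosDef ∧
      ((RidgeKL.minorant (RidgeKL.covMatrix π) (RidgeKL.secondMoment π) U : ℝ) : EReal) ≤
        ((klDiv π (RidgeKL.ridgeApprox π (stdGaussian (EuclideanSpace ℝ (Fin d))) U) : ℝ≥0∞) :
          EReal)) ∧
    (Integrable (fun x => ‖RidgeKL.score p x‖ ^ 2) π →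
      (RidgeKL.fisherMatrix π p).PosDef ∧
      ((klDiv π (RidgeKL.ridgeApprox π (stdGaussian (EuclideanSpace ℝ (Fin d))) U) : ℝ≥0∞) :
          EReal) ≤
        ((RidgeKL.majorant (RidgeKL.fisherMatrix π p) (RidgeKL.secondMoment π) U : ℝ) : EReal)) := by
  have hp1 : ContDiff ℝ 1 p := hp.of_le (by exact_mod_cast le_top)
  refine ⟨⟨RidgeKL.posDef_covMatrix (hπ ▸ withDensity_absolutelyContinuous _ _) hM, ?_⟩,
    fun hS => ⟨RidgeKL.posDef_fisherMatrix hp1 hp0 hπ hM hS, ?_⟩⟩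
  · have h := EReal.coe_ennreal_le_coe_ennreal_iff.2
      (RidgeKL.ofReal_minorant_le_klDiv hp1.continuous.measurable hπ hM hU)
    rw [EReal.coe_ennreal_ofReal] at h
    -- A negative minorant is truncated to zero by `ENNReal.ofReal`, which only strengthens a lower
    -- bound.
    exact (EReal.coe_le_coe_iff.2 (le_max_left _ _)).trans h
  · obtain ⟨h0, h⟩ := RidgeKL.klDiv_le_majorant hp1 hp0 hπ hM hS hU
    have h1 := EReal.coe_ennreal_le_coe_ennreal_iff.2 h
    rwa [EReal.coe_ennreal_ofReal, max_eq_left h0] at h1
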